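/- **Theorem 1.1 (Uniform convergence of renewal measures).** For a probability measure $p$ on $\mathbb{R}$ with finite first moment, let $\mu_p$ be its mean and let $N_p=\sum_{n=0}^{\infty}p^{n*}$ be its renewal measure, where $p^{n*}$ is the $n$-fold convolution of $p$ with itself and $p^{0*}$ is the unit point mass at $0$. For $T>0$, let $C_0^2((-T,T))$ be the set of twice continuously differentiable functions on $\mathbb{R}$ whose support is a compact subset of $(-T,T)$. Let $\mathcal{M}$ be a family of probability measures on $\mathbb{R}$ such that $$\inf_{p\in\mathcal{M}}\mu_p>0,\qquad \sup_{p\in\mathcal{M}}\int_{\mathbb{R}}e^{\tau|x|}\,p(dx)<\infty\ \text{ for some }\tau>0 .$$ Suppose that each $p\in\mathcal{M}$ is a mixture $$p=(1-\lambda_p)\Phi_p+\lambda_p\Psi_p,\qquad 0\le\lambda_p<1,$$ of two probability measures $\Phi_p$ and $\Psi_p$, that $\Phi_p$ has a density $\phi_p\ge 0$ with respect to Lebesgue measure, and that $\sup_{p\in\mathcal{M}}\lambda_p<1$. Suppose furthermore that there is $T\in(0,\infty)$ such that $$\phi_p\in C_0^2((-T,T))\ \text{ for all }p\in\mathcal{M},\qquad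 \sup_{p\in\mathcal{M}}\int_{-T}^{T}|\phi_p''(x)|\,dx<\infty .$$ Then for each $p\in\mathcal{M}$ there are (nonnegative) measures $Q_p$ and $\bar N_p$ on $\mathbb{R}$ with $N_p=Q_p+\bar N_p$, such that $Q_p$ has a density $q_p\ge 0$ with respect to Lebesgue measure, $\sup_{p\in\mathcal{M}}\bar N_p(\mathbb{R})<\infty$, and there is $r_0>0$ such that for all $r\in(0,r_0)$ $$\sup_{x>0,\,p\in\mathcal{M}}e^{rx}\bigl|q_p(x)-\mu_p^{-1}\bigr|+\sup_{x>0,\,p\in\mathcal{M}}e^{rx}q_p(-x)<\infty,$$ $$\sup_{x>0,\,p\in\mathcal{M}}e^{rx}\,\bar N_p\bigl((-\infty,-x]\cup[x,\infty)\bigr)<\infty .$$ The measures $Q_p,\bar N_p$ and the densities $q_p$ do not depend on $r$. -/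

import Mathlib

open MeasureTheory Set

namespace Renewal

/-- The `n`-fold convolution power of a measure on the real line; the zeroth power is the
unit point mass at the origin. -/
noncomputable def convPow (p : Measure ℝ) : ℕ → Measure ℝ
  | 0 => Measure.dirac 0
  | n + 1 => Measure.conv (convPow p n) p

/-- The renewal measure of `p`: the sum over `n ≥ 0` of the `n`-fold convolution powers. -/
noncomputable def renewalMeasure (p : Measure ℝ) : Measure ℝ :=
  Measure.sum (convPow p)

/-- The mean of `p` (used only for measures with a finite first moment). -/
noncomputable def mean (p : Measure ℝ) : ℝ := ∫ x, x ∂p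

/-- The nonnegative real function `f` is a density of `Q` with respect to Lebesgue measure. -/
structure IsDensity (Q : Measure ℝ) (f : ℝ → ℝ) : Prop where
  measurable : Measurable f
  nonneg : ∀ x, 0 ≤ f x
  eq_withDensity : Q = volume.withDensity (fun x => ENNReal.ofReal (f x))

/-- Twice continuously differentiable functions on the line whose support is a compact subset
of the open interval `(-T, T)`. -/
structure IsC2CompactSupportIoo (T : ℝ) (f : ℝ → ℝ) : Prop where
  contDiff : ContDiff ℝ 2 f
  tsupport_subset : tsupport f ⊆ Ioo (-T) T

end Renewal

/-!
The proof combines Stone's decomposition with a contour shift.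

Write `p = S + F` with `S = λ Ψ` and `F = (1 - λ) Φ`. Expanding the convolution powers according to
the last factor `F` gives `N_p = N_S + (N_S ∗ N_p) ∗ F` (`renewalMeasure_add`). The measure `N_S` is
a geometric series of total mass `1 / (1 - λ)`; since `∫ e^{ρ|x|} dS ≤ λ + O(ρ)` uniformly, its
exponential moments of small order are uniformly bounded. This is the part called `Nbar`. The
remaining part has the density `q = κ * g`, where `κ = (1 - λ) N_S` is a probability measure and
`g = φ * N_p`. Averaging over `κ` preserves exponential bounds (`average_bounds`), so that everything
reduces to the two bounds `|g x - 1 / μ| ≤ A e^{-ρx}` and `g x ≤ A e^{ρx}`, valid for all real `x`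
with uniform constants (`smoothed_renewal_bounds`).

Let `p̂` and `φ̂` be the bilateral Laplace transforms. On the line `Re z = -ρ` one has `|p̂| < 1`, so
`N_p` has the transform `1 / (1 - p̂)` there, and Fourier inversion represents `g` as an integral of
`e^{-zx} φ̂ / (1 - p̂)` (`integral_density_sub_eq`). Subtracting the same representation of
`φ * 1_{(0, ∞)} / μ`, whose transform is `-φ̂ / (μ z)`, leaves an integrand whose singularity at the
origin is removable. Hence the line of integration can be moved to `Re z = ρ`
(`integral_vertical_eq`). The two lines give the two bounds, because `φ̂` decays quadratically
(two integrations by parts, `norm_laplace_le_div`).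

Uniformity is the content of `exists_strip_bound`. Near the origin `1 - p̂` is compared with its
linear term `-μ z`. For high imaginary frequencies the decay of `φ̂` keeps `|p̂|` below
`(1 + λ) / 2`. The doubling inequality `1 - |p̂(2it)| ≤ 4 (1 - |p̂(it)|)`, applied finitely often,
carries this down to all frequencies bounded away from zero, and the exponential moments extend the
resulting lower bound from the imaginary axis to a strip.
-/

namespace Renewal

open scoped ENNReal

/-! ### Convolution powers and Stone's decomposition -/

instance isFiniteMeasure_convPow (p : Measure ℝ) [IsFiniteMeasure p] (n : ℕ) :
    IsFiniteMeasure (convPow p n) := by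
  induction n with
  | zero => unfold convPow; infer_instance
  | succ n ih => unfold convPow; infer_instance

instance sFinite_renewalMeasure (p : Measure ℝ) [IsFiniteMeasure p] :
    SFinite (renewalMeasure p) := by
  unfold renewalMeasure; infer_instance

lemma sum_conv {ι : Type*} [Countable ι] (μ : ι → Measure ℝ) (ν : Measure ℝ) [SFinite ν] :
    (Measure.sum μ) ∗ ν = Measure.sum fun i => μ i ∗ ν := by
  refine Measure.ext_of_lintegral _ fun f hf => ?_
  rw [Measure.lintegral_conv hf, lintegral_sum_measure, lintegral_sum_measure]
  simp_rw [Measure.lintegral_conv hf]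

lemma conv_sum {ι : Type*} [Countable ι] (μ : ι → Measure ℝ) [∀ i, SFinite (μ i)]
    (ν : Measure ℝ) [SFinite ν] :
    ν ∗ (Measure.sum μ) = Measure.sum fun i => ν ∗ μ i := by
  rw [Measure.conv_comm, sum_conv]
  simp_rw [Measure.conv_comm _ ν]

lemma conv_right_comm (A B C : Measure ℝ) [SFinite A] [SFinite B] [SFinite C] :
    (A ∗ B) ∗ C = (A ∗ C) ∗ B := by
  rw [Measure.conv_assoc, Measure.conv_comm B C, ← Measure.conv_assoc]

lemma finset_sum_conv {ι : Type*} (s : Finset ι) (μ : ι → Measure ℝ) [∀ i, SFinite (μ i)]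
    (ν : Measure ℝ) [SFinite ν] :
    (∑ i ∈ s, μ i) ∗ ν = ∑ i ∈ s, μ i ∗ ν := by
  refine Measure.ext_of_lintegral _ fun f hf => ?_
  rw [Measure.lintegral_conv hf, lintegral_finsetSum_measure, lintegral_finsetSum_measure]
  simp_rw [Measure.lintegral_conv hf]

/-- A convolution power of `S + F` splits according to the last factor `F` that occurs in the
expanded product. -/
lemma convPow_add_succ (S F : Measure ℝ) [IsFiniteMeasure S] [IsFiniteMeasure F] (n : ℕ) :
    convPow (S + F) (n + 1) = convPow S (n + 1) +
      ∑ ij ∈ Finset.HasAntidiagonal.antidiagonal n,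
        (convPow S ij.1 ∗ convPow (S + F) ij.2) ∗ F := by
  induction n with
  | zero => simp [convPow, Measure.conv_add]
  | succ n ih =>
    have h1 : convPow (S + F) (n + 1 + 1)
        = convPow (S + F) (n + 1) ∗ S + convPow (S + F) (n + 1) ∗ F := by
      rw [← Measure.conv_add]; rfl
    rw [h1, Finset.Nat.sum_antidiagonal_succ]
    have h2 : convPow (S + F) (n + 1) ∗ S = convPow S (n + 1 + 1) +
        ∑ ij ∈ Finset.HasAntidiagonal.antidiagonal n,
          (convPow S (ij.1 + 1) ∗ convPow (S + F) ij.2) ∗ F := by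
      have : SFinite (∑ ij ∈ Finset.HasAntidiagonal.antidiagonal n,
          (convPow S ij.1 ∗ convPow (S + F) ij.2) ∗ F) := by
        infer_instance
      rw [ih, Measure.add_conv, finset_sum_conv]
      congr 1
      refine Finset.sum_congr rfl fun ij _ => ?_
      rw [conv_right_comm _ F S, conv_right_comm _ _ S]
      rfl
    rw [h2, add_assoc, add_comm (∑ ij ∈ Finset.HasAntidiagonal.antidiagonal n, _)]
    simp [convPow]

/-- **Stone's decomposition**: the renewal measure of `S + F` is that of `S` plus a
convolution containing the factor `F`. -/
lemma renewalMeasure_add (S F : Measure ℝ) [IsFiniteMeasure S] [IsFiniteMeasure F] :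
    renewalMeasure (S + F) =
      renewalMeasure S + (renewalMeasure S ∗ renewalMeasure (S + F)) ∗ F := by
  have h : (renewalMeasure S ∗ renewalMeasure (S + F)) ∗ F
      = Measure.sum fun i => Measure.sum fun j => (convPow S i ∗ convPow (S + F) j) ∗ F := by
    conv_lhs => rw [renewalMeasure, sum_conv, sum_conv]
    congr 1; ext1 i
    rw [renewalMeasure, conv_sum, sum_conv]
  rw [h]
  ext s hs
  simp only [renewalMeasure, Measure.add_apply, Measure.sum_apply _ hs]
  rw [tsum_eq_zero_add' ENNReal.summable, tsum_eq_zero_add' (f := fun n => convPow S n s)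
    ENNReal.summable]
  simp_rw [convPow_add_succ, Measure.add_apply, Measure.finsetSum_apply]
  rw [ENNReal.tsum_add, ← ENNReal.tsum_prod (f := fun i j =>
    (((convPow S i ∗ convPow (S + F) j) ∗ F) s)),
    ← Finset.HasAntidiagonal.sigmaAntidiagonalEquivProd.tsum_eq, ENNReal.tsum_sigma', add_assoc]
  congr 2
  refine tsum_congr fun n => ?_
  rw [← Finset.tsum_subtype]
  rfl

lemma lintegral_convPow_le {f : ℝ → ℝ≥0∞} (hf : Measurable f) (h0 : f 0 = 1)
    (hadd : ∀ x y, f (x + y) ≤ f x * f y) (p : Measure ℝ) [IsFiniteMeasure p] (n : ℕ) :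
    ∫⁻ x, f x ∂(convPow p n) ≤ (∫⁻ x, f x ∂p) ^ n := by
  induction n with
  | zero => simp [convPow, lintegral_dirac' _ hf, h0]
  | succ n ih =>
    rw [convPow, Measure.lintegral_conv hf, pow_succ]
    calc _ ≤ ∫⁻ x, f x * ∫⁻ y, f y ∂p ∂(convPow p n) := by
          gcongr with x
          rw [← lintegral_const_mul _ hf]
          exact lintegral_mono fun y => hadd x y
      _ = (∫⁻ x, f x ∂(convPow p n)) * ∫⁻ y, f y ∂p := lintegral_mul_const _ hf
      _ ≤ _ := by gcongr

/-- A submultiplicative function is integrated by the renewal measure at most as by a geometric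
series; in particular the integral is finite as soon as `∫ f ∂p < 1`. -/
lemma lintegral_renewalMeasure_le {f : ℝ → ℝ≥0∞} (hf : Measurable f) (h0 : f 0 = 1)
    (hadd : ∀ x y, f (x + y) ≤ f x * f y) (p : Measure ℝ) [IsFiniteMeasure p] :
    ∫⁻ x, f x ∂(renewalMeasure p) ≤ (1 - ∫⁻ x, f x ∂p)⁻¹ := by
  rw [renewalMeasure, lintegral_sum_measure, ← ENNReal.tsum_geometric]
  exact ENNReal.tsum_le_tsum fun n => lintegral_convPow_le hf h0 hadd p n

lemma renewalMeasure_univ (p : Measure ℝ) [IsFiniteMeasure p] :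
    renewalMeasure p univ = (1 - p univ)⁻¹ := by
  have h (n : ℕ) : convPow p n univ = p univ ^ n := by
    induction n with
    | zero => simp [convPow]
    | succ n ih =>
      rw [convPow, Measure.conv, Measure.map_apply (by fun_prop) .univ, preimage_univ,
        ← univ_prod_univ, Measure.prod_prod, ih, pow_succ]
  rw [renewalMeasure, Measure.sum_apply _ .univ, ← ENNReal.tsum_geometric]
  simp_rw [h]

/-- The nonnegative density, with values in `ℝ≥0∞`, of the convolution of a measure with an
absolutely continuous one. -/
lemma conv_withDensity (ν : Measure ℝ) [SFinite ν] {f : ℝ → ℝ≥0∞} (hf : Measurable f)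
    [SFinite (volume.withDensity f)] :
    ν ∗ volume.withDensity f = volume.withDensity fun x => ∫⁻ y, f (x - y) ∂ν := by
  refine Measure.ext_of_lintegral _ fun h hh => ?_
  have hm : Measurable (Function.uncurry fun x y : ℝ => f (x - y)) :=
    hf.comp (measurable_fst.sub measurable_snd)
  rw [Measure.lintegral_conv hh, lintegral_withDensity_eq_lintegral_mul _
    (Measurable.lintegral_prod_right hm) hh]
  calc ∫⁻ x, ∫⁻ y, h (x + y) ∂(volume.withDensity f) ∂ν
      = ∫⁻ x, (∫⁻ y, f (y - x) * h y) ∂ν := by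
        refine lintegral_congr fun x => ?_
        rw [lintegral_withDensity_eq_lintegral_mul _ hf
            (show Measurable fun y => h (x + y) from hh.comp (measurable_const_add x)),
          ← lintegral_add_right_eq_self _ (-x)]
        refine lintegral_congr fun y => ?_
        simp [sub_eq_add_neg]
    _ = ∫⁻ y, (∫⁻ x, f (y - x) * h y ∂ν) := by
        refine lintegral_lintegral_swap (Measurable.aemeasurable ?_)
        exact (hf.comp (measurable_snd.sub measurable_fst)).mul (hh.comp measurable_snd)
    _ = _ := by
        refine lintegral_congr fun y => ?_
        exact lintegral_mul_const _ (hf.comp (measurable_const.sub measurable_id))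

/-! ### The bilateral Laplace transform -/

/-- The bilateral Laplace transform `z ↦ ∫ e^{zx} p(dx)` of a measure on the line, that is,
the complex moment generating function of the identity. -/
noncomputable def laplace (p : Measure ℝ) (z : ℂ) : ℂ := ∫ x, Complex.exp (z * (x : ℂ)) ∂p

lemma norm_cexp_mul_ofReal (z : ℂ) (x : ℝ) : ‖Complex.exp (z * x)‖ = Real.exp (z.re * x) := by
  simp [Complex.norm_exp]

lemma integrable_cexp {p : Measure ℝ} {z : ℂ} (h : Integrable (fun x => Real.exp (z.re * x)) p) :
    Integrable (fun x : ℝ => Complex.exp (z * x)) p :=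
  h.mono' (by fun_prop) (.of_forall fun x => (norm_cexp_mul_ofReal z x).le)

lemma norm_laplace_le (p : Measure ℝ) (z : ℂ) :
    ‖laplace p z‖ ≤ ∫ x, Real.exp (z.re * x) ∂p := by
  refine (norm_integral_le_integral_norm _).trans_eq ?_
  simp_rw [norm_cexp_mul_ofReal]

lemma laplace_zero (p : Measure ℝ) [IsProbabilityMeasure p] : laplace p 0 = 1 := by
  simp [laplace]

lemma ofReal_exp_add (σ x y : ℝ) : ENNReal.ofReal (Real.exp (σ * (x + y)))
    = ENNReal.ofReal (Real.exp (σ * x)) * ENNReal.ofReal (Real.exp (σ * y)) := by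
  rw [← ENNReal.ofReal_mul (Real.exp_nonneg _), ← Real.exp_add, mul_add]

lemma integrable_iff_lintegral_ofReal_exp {p : Measure ℝ} {f : ℝ → ℝ} (hf : Measurable f) :
    Integrable (fun x => Real.exp (f x)) p ↔
      ∫⁻ x, ENNReal.ofReal (Real.exp (f x)) ∂p < ∞ := by
  rw [Integrable, and_iff_right (by fun_prop : AEStronglyMeasurable _ _),
    hasFiniteIntegral_iff_ofReal (.of_forall fun x => Real.exp_nonneg _)]

lemma integrable_exp_convPow {p : Measure ℝ} [IsFiniteMeasure p] {σ : ℝ}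
    (h : Integrable (fun x => Real.exp (σ * x)) p) (n : ℕ) :
    Integrable (fun x => Real.exp (σ * x)) (convPow p n) := by
  rw [integrable_iff_lintegral_ofReal_exp (by fun_prop)] at h ⊢
  exact (lintegral_convPow_le (by fun_prop) (by simp)
    (fun x y => (ofReal_exp_add σ x y).le) p n).trans_lt (ENNReal.pow_lt_top h)

lemma laplace_convPow {p : Measure ℝ} [IsFiniteMeasure p] {z : ℂ}
    (h : Integrable (fun x => Real.exp (z.re * x)) p) (n : ℕ) :
    laplace (convPow p n) z = laplace p z ^ n := by
  induction n with
  | zero => simp [convPow, laplace]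
  | succ n ih =>
    have hi := integrable_cexp (integrable_exp_convPow h (n + 1))
    rw [convPow] at hi
    rw [laplace, convPow, integral_conv hi, pow_succ, ← ih]
    simp_rw [Complex.ofReal_add, mul_add, Complex.exp_add, integral_const_mul]
    rw [integral_mul_const]
    rfl

lemma integrable_exp_renewalMeasure {p : Measure ℝ} [IsFiniteMeasure p] {σ : ℝ}
    (h : Integrable (fun x => Real.exp (σ * x)) p) (h1 : ∫ x, Real.exp (σ * x) ∂p < 1) :
    Integrable (fun x => Real.exp (σ * x)) (renewalMeasure p) := by
  rw [integrable_iff_lintegral_ofReal_exp (by fun_prop)]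
  refine (lintegral_renewalMeasure_le (by fun_prop) (by simp)
    (fun x y => (ofReal_exp_add σ x y).le) p).trans_lt ?_
  rw [← ofReal_integral_eq_lintegral_ofReal h (.of_forall fun x => Real.exp_nonneg _)]
  simpa using h1

/-- On a vertical line where the moment generating function is less than one, the transform of
the renewal measure is the sum of a geometric series. -/
lemma laplace_renewalMeasure {p : Measure ℝ} [IsFiniteMeasure p] {z : ℂ}
    (h : Integrable (fun x => Real.exp (z.re * x)) p) (h1 : ∫ x, Real.exp (z.re * x) ∂p < 1) :
    laplace (renewalMeasure p) z = (1 - laplace p z)⁻¹ := by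
  have hs := hasSum_integral_measure (μ := convPow p)
    (integrable_cexp (integrable_exp_renewalMeasure h h1))
  have hg := hasSum_geometric_of_norm_lt_one ((norm_laplace_le p z).trans_lt h1)
  refine HasSum.unique hs ?_
  simp_rw [← laplace_convPow h] at hg
  exact hg

/-! ### Bounds near the imaginary axis -/

lemma abs_exp_sub_one_le_exp_abs (y : ℝ) : |Real.exp y - 1| ≤ Real.exp |y| - 1 := by
  rcases le_total 0 y with hy | hy
  · rw [abs_of_nonneg hy, abs_of_nonneg (by linarith [Real.add_one_le_exp y])]
  · rw [abs_of_nonpos hy, abs_of_nonpos (by linarith [Real.exp_le_one_iff.2 hy])]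
    have := Real.add_one_le_exp y
    have := Real.add_one_le_exp (-y)
    linarith

/-- Convexity of the exponential function along `[0, τ * |x|]`. -/
lemma exp_mul_abs_sub_one_le {σ τ : ℝ} (hτ : 0 < τ) (hσ : 0 ≤ σ) (hστ : σ ≤ τ) (x : ℝ) :
    Real.exp (σ * |x|) - 1 ≤ σ / τ * Real.exp (τ * |x|) := by
  have h := convexOn_exp.2 (mem_univ (0 : ℝ)) (mem_univ (τ * |x|))
    (sub_nonneg.2 ((div_le_one hτ).2 hστ)) (div_nonneg hσ hτ.le) (by ring)
  have e : σ / τ * (τ * |x|) = σ * |x| := by field_simp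
  simp only [smul_eq_mul, mul_zero, zero_add, Real.exp_zero, mul_one, e] at h
  have := div_nonneg hσ hτ.le
  linarith

section Moments

variable {p : Measure ℝ} {τ C : ℝ}

lemma integrable_exp_mul [IsFiniteMeasure p] (hi : Integrable (fun x => Real.exp (τ * |x|)) p)
    {σ : ℝ} (hσ : |σ| ≤ τ) : Integrable (fun x => Real.exp (σ * x)) p :=
  hi.mono' (by fun_prop) (.of_forall fun x => by
    rw [Real.norm_eq_abs, Real.abs_exp, Real.exp_le_exp]
    calc σ * x ≤ |σ * x| := le_abs_self _
      _ = |σ| * |x| := abs_mul _ _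
      _ ≤ τ * |x| := by gcongr)

lemma integrable_id_of_exp [IsFiniteMeasure p] (hτ : 0 < τ)
    (hi : Integrable (fun x => Real.exp (τ * |x|)) p) : Integrable (fun x : ℝ => x) p := by
  refine (hi.const_mul τ⁻¹).mono' (by fun_prop) (.of_forall fun x => ?_)
  rw [Real.norm_eq_abs, ← div_eq_inv_mul, le_div_iff₀ hτ]
  linarith [Real.add_one_le_exp (τ * |x|)]

/-- Second order expansion of the transform at the origin, with explicit uniform error. -/
lemma norm_laplace_sub_le [IsProbabilityMeasure p] (hτ : 0 < τ)
    (hi : Integrable (fun x => Real.exp (τ * |x|)) p) (hC : ∫ x, Real.exp (τ * |x|) ∂p ≤ C)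
    {z : ℂ} (hz : ‖z‖ ≤ τ / 2) :
    ‖laplace p z - 1 - mean p * z‖ ≤ 8 * C / τ ^ 2 * ‖z‖ ^ 2 := by
  have hre : |z.re| ≤ τ := (Complex.abs_re_le_norm z).trans (by linarith)
  have he := integrable_cexp (integrable_exp_mul hi hre)
  have hid := integrable_id_of_exp hτ hi
  have hidz : Integrable (fun x : ℝ => z * (x : ℂ)) p := hid.ofReal.const_mul z
  have e : laplace p z - 1 - mean p * z
      = ∫ x : ℝ, (Complex.exp (z * x) - 1 - z * x) ∂p := by
    have e1 : ∫ x : ℝ, (Complex.exp (z * x) - 1) ∂p = laplace p z - 1 := by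
      rw [integral_sub he (integrable_const _)]
      simp [laplace]
    have e2 : ∫ x : ℝ, z * (x : ℂ) ∂p = mean p * z := by
      rw [integral_const_mul, integral_complex_ofReal, mean, mul_comm]
    have he1 : Integrable (fun x : ℝ => Complex.exp (z * x) - 1) p :=
      he.sub (integrable_const _)
    rw [integral_sub he1 hidz, e1, e2]
  have hpt (x : ℝ) : ‖Complex.exp (z * x) - 1 - z * x‖
      ≤ 8 / τ ^ 2 * ‖z‖ ^ 2 * Real.exp (τ * |x|) := by
    have h1 := Complex.norm_exp_sub_sum_le_norm_mul_exp (z * x) 2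
    simp only [Finset.sum_range_succ, Finset.range_zero, Finset.sum_empty, pow_zero,
      Nat.factorial, pow_one, zero_add, Nat.cast_one, div_one, mul_one, norm_mul,
      Complex.norm_real, Real.norm_eq_abs, ← sub_sub] at h1
    refine h1.trans ?_
    have h2 : x ^ 2 ≤ 8 / τ ^ 2 * Real.exp (τ / 2 * |x|) := by
      have := Real.quadratic_le_exp_of_nonneg (x := τ / 2 * |x|) (by positivity)
      rw [div_mul_eq_mul_div, le_div_iff₀ (by positivity)]
      have h3 : (τ / 2 * |x|) ^ 2 = τ ^ 2 / 4 * x ^ 2 := by rw [mul_pow, sq_abs]; ring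
      have : 0 ≤ τ / 2 * |x| := by positivity
      nlinarith
    calc (‖z‖ * |x|) ^ 2 * Real.exp (‖z‖ * |x|)
        ≤ (‖z‖ * |x|) ^ 2 * Real.exp (τ / 2 * |x|) := by gcongr
      _ = ‖z‖ ^ 2 * x ^ 2 * Real.exp (τ / 2 * |x|) := by rw [mul_pow, sq_abs]
      _ ≤ ‖z‖ ^ 2 * (8 / τ ^ 2 * Real.exp (τ / 2 * |x|)) * Real.exp (τ / 2 * |x|) := by gcongr
      _ = 8 / τ ^ 2 * ‖z‖ ^ 2 * (Real.exp (τ / 2 * |x|) * Real.exp (τ / 2 * |x|)) := by ring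
      _ = _ := by rw [← Real.exp_add]; ring_nf
  rw [e]
  calc _ ≤ ∫ x : ℝ, 8 / τ ^ 2 * ‖z‖ ^ 2 * Real.exp (τ * |x|) ∂p :=
        norm_integral_le_of_norm_le (hi.const_mul _) (.of_forall hpt)
    _ = 8 / τ ^ 2 * ‖z‖ ^ 2 * ∫ x : ℝ, Real.exp (τ * |x|) ∂p := integral_const_mul _ _
    _ ≤ 8 / τ ^ 2 * ‖z‖ ^ 2 * C := by gcongr
    _ = _ := by ring

/-- The transform moves little when its argument is shifted horizontally. -/
lemma norm_laplace_sub_im_le [IsFiniteMeasure p] (hτ : 0 < τ)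
    (hi : Integrable (fun x => Real.exp (τ * |x|)) p) (hC : ∫ x, Real.exp (τ * |x|) ∂p ≤ C)
    {z : ℂ} (hz : |z.re| ≤ τ) :
    ‖laplace p z - laplace p (z.im * Complex.I)‖ ≤ |z.re| / τ * C := by
  have h1 := integrable_cexp (integrable_exp_mul hi hz)
  have h2 : Integrable (fun x : ℝ => Complex.exp (z.im * Complex.I * x)) p :=
    integrable_cexp (by simp)
  rw [laplace, laplace, ← integral_sub h1 h2]
  have hpt (x : ℝ) : ‖Complex.exp (z * x) - Complex.exp (z.im * Complex.I * x)‖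
      ≤ |z.re| / τ * Real.exp (τ * |x|) := by
    have e : Complex.exp (z * x) - Complex.exp (z.im * Complex.I * x)
        = Complex.exp (z.im * Complex.I * x) * ((Real.exp (z.re * x) - 1 : ℝ) : ℂ) := by
      push_cast
      rw [mul_sub, ← Complex.exp_add, mul_one]
      congr 2
      conv_lhs => rw [← Complex.re_add_im z]
      ring
    rw [e, norm_mul, norm_cexp_mul_ofReal, Complex.norm_real, Real.norm_eq_abs]
    simp only [Complex.mul_re, Complex.ofReal_re, Complex.I_re, Complex.ofReal_im, mul_zero,
      zero_mul, sub_zero, Real.exp_zero, one_mul]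
    refine (abs_exp_sub_one_le_exp_abs _).trans ?_
    rw [abs_mul]
    exact exp_mul_abs_sub_one_le hτ (abs_nonneg _) hz x
  calc _ ≤ ∫ x : ℝ, |z.re| / τ * Real.exp (τ * |x|) ∂p :=
        norm_integral_le_of_norm_le (hi.const_mul _) (.of_forall hpt)
    _ = |z.re| / τ * ∫ x : ℝ, Real.exp (τ * |x|) ∂p := integral_const_mul _ _
    _ ≤ _ := by gcongr

end Moments

/-- Doubling inequality for characteristic functions: the defect `1 - |p̂|` grows at most by a
factor four when the frequency is doubled. It comes from `1 - cos 2θ ≤ 4 (1 - cos θ)`, after a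
rotation that makes `p̂(t)` real and nonnegative. -/
lemma one_sub_norm_laplace_two_mul_le (p : Measure ℝ) [IsProbabilityMeasure p] (t : ℝ) :
    1 - ‖laplace p ((2 * t : ℝ) * Complex.I)‖ ≤ 4 * (1 - ‖laplace p (t * Complex.I)‖) := by
  obtain ⟨c, hc, hct⟩ := Complex.exists_norm_eq_mul_self (laplace p (t * Complex.I))
  have hint (s : ℝ) (c : ℂ) :
      Integrable (fun x : ℝ => c * Complex.exp (s * Complex.I * x)) p :=
    (integrable_cexp (by simp)).const_mul c
  have hre (s : ℝ) (c : ℂ) :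
      Integrable (fun x : ℝ => (c * Complex.exp (s * Complex.I * x)).re) p := (hint s c).re
  have h1 : ‖laplace p (t * Complex.I)‖
      = ∫ x : ℝ, (c * Complex.exp (t * Complex.I * x)).re ∂p := by
    have := congrArg Complex.re hct
    rw [Complex.ofReal_re, laplace, ← integral_const_mul] at this
    rw [laplace, this]
    exact (integral_re (hint t c)).symm
  have h2 : ∫ x : ℝ, (c ^ 2 * Complex.exp ((2 * t : ℝ) * Complex.I * x)).re ∂p
      ≤ ‖laplace p ((2 * t : ℝ) * Complex.I)‖ := by
    have : ∫ x : ℝ, (c ^ 2 * Complex.exp ((2 * t : ℝ) * Complex.I * x)).re ∂p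
        = (c ^ 2 * laplace p ((2 * t : ℝ) * Complex.I)).re := by
      rw [laplace, ← integral_const_mul]
      exact integral_re (hint (2 * t) (c ^ 2))
    rw [this]
    refine (Complex.re_le_norm _).trans ?_
    simp [hc]
  have h3 : ∫ x : ℝ, (4 * (c * Complex.exp (t * Complex.I * x)).re - 3) ∂p
      ≤ ∫ x : ℝ, (c ^ 2 * Complex.exp ((2 * t : ℝ) * Complex.I * x)).re ∂p := by
    refine integral_mono (((hre t c).const_mul 4).sub (integrable_const _))
      (hre (2 * t) (c ^ 2)) fun x => ?_
    have e : c ^ 2 * Complex.exp ((2 * t : ℝ) * Complex.I * x)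
        = (c * Complex.exp (t * Complex.I * x)) ^ 2 := by
      rw [mul_pow, ← Complex.exp_nat_mul]; push_cast; ring_nf
    beta_reduce
    rw [e]
    set v := c * Complex.exp (t * Complex.I * x) with hv
    have hn : ‖v‖ = 1 := by
      rw [hv, norm_mul, hc, norm_cexp_mul_ofReal]; simp
    have hn2 : v.re * v.re + v.im * v.im = 1 := by
      rw [← Complex.normSq_apply, Complex.normSq_eq_norm_sq, hn, one_pow]
    rw [pow_two, Complex.mul_re v v]
    nlinarith [sq_nonneg (v.re - 1)]
  rw [integral_sub ((hre t c).const_mul 4) (integrable_const _), integral_const_mul, ← h1] at h3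
  simp only [integral_const, probReal_univ, smul_eq_mul, one_mul] at h3
  linarith

lemma one_sub_norm_laplace_two_pow_mul_le (p : Measure ℝ) [IsProbabilityMeasure p] (t : ℝ)
    (k : ℕ) : 1 - ‖laplace p ((2 ^ k * t : ℝ) * Complex.I)‖
      ≤ 4 ^ k * (1 - ‖laplace p (t * Complex.I)‖) := by
  induction k with
  | zero => simp
  | succ k ih =>
    have := one_sub_norm_laplace_two_mul_le p (2 ^ k * t)
    rw [pow_succ' 2 k, pow_succ' 4 k, mul_assoc, mul_assoc]
    linarith

/-! ### Uniform nonvanishing in a strip -/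

/-- For a class of laws with uniformly bounded exponential moment, mean bounded below and
characteristic function bounded away from one at high frequencies, there is a common vertical strip
in which `1 - p̂` vanishes only at the origin, and in which the polar part `-1 / (μ z)` of
`1 / (1 - p̂)` leaves a uniformly bounded remainder. -/
lemma exists_strip_bound {τ C m t₀ θ : ℝ} (hτ : 0 < τ) (hC1 : 1 ≤ C) (hm : 0 < m) (hθ : θ < 1) :
    ∃ ρ : ℝ, 0 < ρ ∧ ρ < τ ∧ ∃ B : ℝ, 0 ≤ B ∧ ∀ (p : Measure ℝ) [IsProbabilityMeasure p],
      Integrable (fun x => Real.exp (τ * |x|)) p → ∫ x, Real.exp (τ * |x|) ∂p ≤ C →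
      m ≤ mean p → (∀ t : ℝ, t₀ ≤ |t| → ‖laplace p (t * Complex.I)‖ ≤ θ) →
      (∀ z : ℂ, |z.re| ≤ ρ → z ≠ 0 → 1 - laplace p z ≠ 0 ∧
        ‖(1 - laplace p z)⁻¹ + (mean p * z)⁻¹‖ ≤ B) ∧
      ∀ σ : ℝ, 0 < σ → σ ≤ ρ → ∫ x, Real.exp (-σ * x) ∂p < 1 := by
  set C₂ : ℝ := 8 * C / τ ^ 2 with hC₂
  have hC₂pos : 0 < C₂ := by positivity
  -- inside the disc of radius `δ` the linear term of `1 - p̂` dominates the quadratic error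
  set δ : ℝ := min (τ / 2) (m / (2 * C₂)) with hδ
  have hδpos : 0 < δ := by positivity
  have hδτ : δ ≤ τ / 2 := min_le_left _ _
  have hδm : C₂ * δ ≤ m / 2 := by
    have : δ ≤ m / (2 * C₂) := min_le_right _ _
    rw [le_div_iff₀ (by positivity)] at this
    linarith
  obtain ⟨k, hk⟩ := pow_unbounded_of_one_lt (t₀ / (δ / 2)) one_lt_two
  have hk' : t₀ ≤ 2 ^ k * (δ / 2) := by
    rw [div_lt_iff₀ (by positivity)] at hk
    exact hk.le
  -- lower bound for `1 - |p̂(it)|` when `|t| ≥ δ / 2`: after `k` doublings the frequency exceeds `t₀`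
  set c : ℝ := (1 - θ) / 4 ^ k with hc
  have hcpos : 0 < c := div_pos (by linarith) (by positivity)
  -- the shift from the imaginary axis costs at most half of the lower bound `c` valid there
  set ρ : ℝ := min (δ / 2) (c * τ / (2 * C)) with hρ
  have hρpos : 0 < ρ := by positivity
  have hρδ : ρ ≤ δ / 2 := min_le_left _ _
  have hρc : ρ / τ * C ≤ c / 2 := by
    have : ρ ≤ c * τ / (2 * C) := min_le_right _ _
    rw [le_div_iff₀ (by positivity)] at this
    rw [div_mul_eq_mul_div, div_le_iff₀ hτ]
    linarith
  refine ⟨ρ, hρpos, by linarith, 2 * C₂ / m ^ 2 + (2 / c + 2 / (m * δ)), by positivity, ?_⟩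
  intro p _ hi hC hmean hhigh
  have hμ : 0 < mean p := hm.trans_le hmean
  have hnear (z : ℂ) (hz : ‖z‖ ≤ δ) : ‖laplace p z - 1 - mean p * z‖ ≤ C₂ * ‖z‖ ^ 2 :=
    norm_laplace_sub_le hτ hi hC (hz.trans hδτ)
  refine ⟨fun z hz hz0 => ?_, fun σ hσ hσρ => ?_⟩
  · have hz0' : 0 < ‖z‖ := norm_pos_iff.2 hz0
    have hμz : ‖(mean p : ℂ) * z‖ = mean p * ‖z‖ := by
      rw [norm_mul, Complex.norm_real, Real.norm_of_nonneg hμ.le]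
    rcases le_or_gt ‖z‖ δ with hzδ | hzδ
    · have h1 := hnear z hzδ
      have hlow : m / 2 * ‖z‖ ≤ ‖1 - laplace p z‖ := by
        have h2 : ‖(mean p : ℂ) * z‖ ≤ ‖1 - laplace p z‖ + ‖laplace p z - 1 - mean p * z‖ := by
          rw [← norm_neg ((mean p : ℂ) * z)]
          refine le_trans (le_of_eq ?_) (norm_add_le _ _)
          congr 1; ring
        have h3 : C₂ * ‖z‖ ^ 2 ≤ m / 2 * ‖z‖ := by
          rw [pow_two, ← mul_assoc]
          gcongr
          exact (mul_le_mul_of_nonneg_left hzδ hC₂pos.le).trans hδm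
        have h4 : m * ‖z‖ ≤ mean p * ‖z‖ := by gcongr
        rw [hμz] at h2
        linarith
      have hpos : 0 < ‖1 - laplace p z‖ := lt_of_lt_of_le (by positivity) hlow
      have hne : 1 - laplace p z ≠ 0 := norm_pos_iff.1 hpos
      refine ⟨hne, ?_⟩
      have e : (1 - laplace p z)⁻¹ + (mean p * z)⁻¹
          = -(laplace p z - 1 - mean p * z) / ((1 - laplace p z) * (mean p * z)) := by
        have : (mean p : ℂ) ≠ 0 := by exact_mod_cast hμ.ne'
        field_simp
        ring
      rw [e, norm_div, norm_neg, norm_mul, hμz]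
      calc ‖laplace p z - 1 - mean p * z‖ / (‖1 - laplace p z‖ * (mean p * ‖z‖))
          ≤ C₂ * ‖z‖ ^ 2 / (m / 2 * ‖z‖ * (m * ‖z‖)) := by gcongr
        _ = 2 * C₂ / m ^ 2 := by field_simp
        _ ≤ _ := le_add_of_nonneg_right (by positivity)
    · have him : δ / 2 ≤ |z.im| := by
        have := Complex.norm_le_abs_re_add_abs_im z
        linarith
      have h1 : c ≤ 1 - ‖laplace p (z.im * Complex.I)‖ := by
        have h2 := one_sub_norm_laplace_two_pow_mul_le p z.im k
        have h3 : ‖laplace p ((2 ^ k * z.im : ℝ) * Complex.I)‖ ≤ θ := by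
          refine hhigh _ (hk'.trans ?_)
          rw [abs_mul, abs_of_nonneg (by positivity : (0 : ℝ) ≤ 2 ^ k)]
          gcongr
        rw [hc, div_le_iff₀ (by positivity)]
        linarith
      have h2 : ‖laplace p z - laplace p (z.im * Complex.I)‖ ≤ c / 2 := by
        refine (norm_laplace_sub_im_le hτ hi hC (by linarith)).trans (le_trans ?_ hρc)
        gcongr
      have hlow : c / 2 ≤ ‖1 - laplace p z‖ := by
        have h3 : 1 - ‖laplace p z‖ ≤ ‖1 - laplace p z‖ := by
          simpa using norm_sub_norm_le (1 : ℂ) (laplace p z)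
        have h4 := norm_sub_norm_le (laplace p z) (laplace p (z.im * Complex.I))
        linarith
      refine ⟨norm_pos_iff.1 (lt_of_lt_of_le (by positivity) hlow), ?_⟩
      calc ‖(1 - laplace p z)⁻¹ + (mean p * z)⁻¹‖
          ≤ ‖1 - laplace p z‖⁻¹ + (mean p * ‖z‖)⁻¹ := by
            rw [← norm_inv, ← hμz, ← norm_inv]; exact norm_add_le _ _
        _ ≤ (c / 2)⁻¹ + (m * (δ / 2))⁻¹ := by
            gcongr; linarith
        _ = 2 / c + 2 / (m * δ) := by field_simp
        _ ≤ _ := le_add_of_nonneg_left (by positivity)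
  · have hnσ : ‖((-σ : ℝ) : ℂ)‖ = σ := by
      rw [Complex.norm_real, Real.norm_eq_abs, abs_neg, abs_of_pos hσ]
    have h1 := hnear ((-σ : ℝ) : ℂ) (by rw [hnσ]; linarith)
    have h2 : laplace p ((-σ : ℝ) : ℂ) = ((∫ x, Real.exp (-σ * x) ∂p : ℝ) : ℂ) := by
      rw [laplace, ← integral_complex_ofReal]
      simp
    rw [h2, hnσ] at h1
    have h3 := (Complex.re_le_norm _).trans h1
    rw [← Complex.ofReal_mul, ← Complex.ofReal_one, ← Complex.ofReal_sub, ← Complex.ofReal_sub,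
      Complex.ofReal_re] at h3
    have h4 : C₂ * σ ^ 2 ≤ m / 2 * σ := by
      rw [pow_two, ← mul_assoc]
      gcongr
      exact (mul_le_mul_of_nonneg_left (by linarith : σ ≤ δ) hC₂pos.le).trans hδm
    have h5 : m * σ ≤ mean p * σ := by gcongr
    have : 0 < m * σ := by positivity
    linarith

/-! ### Moving a line of integration -/

/-- Cauchy's theorem for a vertical strip: if `H` is holomorphic in the closed strip and decays
quadratically, its integrals over the two boundary lines agree. -/
lemma integral_vertical_eq {H : ℂ → ℂ} {a b B : ℝ} (hab : a ≤ b)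
    (hd : DifferentiableOn ℂ H {z | z.re ∈ Icc a b})
    (hB : ∀ z : ℂ, z.re ∈ Icc a b → 1 ≤ |z.im| → ‖H z‖ ≤ B / (1 + z.im ^ 2))
    (ha : Integrable fun t : ℝ => H (a + t * Complex.I))
    (hb : Integrable fun t : ℝ => H (b + t * Complex.I)) :
    ∫ t : ℝ, H (a + t * Complex.I) = ∫ t : ℝ, H (b + t * Complex.I) := by
  open Filter Topology in
  have ta := intervalIntegral_tendsto_integral ha tendsto_neg_atTop_atBot tendsto_id
  have tb := intervalIntegral_tendsto_integral hb tendsto_neg_atTop_atBot tendsto_id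
  have hdec : Tendsto (fun R : ℝ => B / (1 + R ^ 2) * (b - a)) atTop (𝓝 0) := by
    have : Tendsto (fun R : ℝ => 1 + R ^ 2) atTop atTop :=
      tendsto_atTop_add_const_left _ _ (tendsto_pow_atTop two_ne_zero)
    simpa using (this.const_div_atTop B).mul_const (b - a)
  have hhor (s : ℝ) (hs : s ^ 2 = 1) : Tendsto (fun R : ℝ =>
      ∫ x : ℝ in a..b, H (x + (s * R : ℝ) * Complex.I)) atTop (𝓝 0) := by
    refine squeeze_zero_norm' ?_ hdec
    filter_upwards [eventually_ge_atTop 1] with R hR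
    rw [← abs_of_nonneg (sub_nonneg.2 hab)]
    refine intervalIntegral.norm_integral_le_of_norm_le_const fun x hx => ?_
    rw [uIoc_of_le hab] at hx
    have h := hB (x + (s * R : ℝ) * Complex.I) (by simpa using ⟨hx.1.le, hx.2⟩)
      (by
        rw [← Real.sqrt_sq_eq_abs]
        simpa [mul_pow, hs, Real.sqrt_sq_eq_abs] using hR.trans (le_abs_self R))
    simpa [mul_pow, hs] using h
  have hrect (R : ℝ) : (∫ x : ℝ in a..b, H (x + ((-1) * R : ℝ) * Complex.I))
      - (∫ x : ℝ in a..b, H (x + (1 * R : ℝ) * Complex.I))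
      + Complex.I • (∫ t : ℝ in -R..id R, H (b + t * Complex.I))
      - Complex.I • (∫ t : ℝ in -R..id R, H (a + t * Complex.I)) = 0 := by
    have := Complex.integral_boundary_rect_eq_zero_of_differentiableOn H
      ⟨a, -R⟩ ⟨b, R⟩ (hd.mono fun z hz => by
        have := hz.1
        simpa [uIcc_of_le hab] using this)
    simpa using this
  have hlim := (((hhor (-1) (by norm_num)).sub (hhor 1 (by norm_num))).add
    (tb.const_smul Complex.I)).sub (ta.const_smul Complex.I)
  have h0 := tendsto_nhds_unique (hlim.congr hrect) tendsto_const_nhds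
  rw [sub_zero, zero_add, ← smul_sub, smul_eq_zero] at h0
  exact (sub_eq_zero.1 (h0.resolve_left Complex.I_ne_zero)).symm

/-! ### Transforms of twice differentiable densities -/

section Density

variable {T K : ℝ} {φ : ℝ → ℝ} {Φ : Measure ℝ}

lemma IsC2CompactSupportIoo.hasCompactSupport (h : IsC2CompactSupportIoo T φ) :
    HasCompactSupport φ :=
  isCompact_Icc.of_isClosed_subset (isClosed_tsupport _)
    (h.tsupport_subset.trans Ioo_subset_Icc_self)

lemma IsC2CompactSupportIoo.continuous (h : IsC2CompactSupportIoo T φ) : Continuous φ :=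
  h.contDiff.continuous

lemma integrable_cexp_mul {f : ℝ → ℝ} (hf : Continuous f) (hs : HasCompactSupport f) (z : ℂ) :
    Integrable fun x : ℝ => Complex.exp (z * x) * f x := by
  refine Continuous.integrable_of_hasCompactSupport (by fun_prop) ?_
  exact (hs.comp_left (g := ((↑) : ℝ → ℂ)) Complex.ofReal_zero).mul_left

/-- Integration by parts for the bilateral Laplace transform. -/
lemma integral_cexp_mul_deriv {f : ℝ → ℝ} (hf : ContDiff ℝ 1 f) (hs : HasCompactSupport f)
    (z : ℂ) : ∫ x : ℝ, Complex.exp (z * x) * (deriv f x : ℝ)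
      = -(z * ∫ x : ℝ, Complex.exp (z * x) * f x) := by
  have hd := hf.continuous_deriv le_rfl
  have h := integral_mul_deriv_eq_deriv_mul_of_integrable
    (u := fun x : ℝ => Complex.exp (z * x)) (u' := fun x : ℝ => z * Complex.exp (z * x))
    (v := fun x : ℝ => (f x : ℂ)) (v' := fun x : ℝ => ((deriv f x : ℝ) : ℂ))
    (fun x _ => by
      have := ((Complex.ofRealCLM.hasDerivAt (x := x)).const_mul z).cexp
      simpa [mul_comm] using this)
    (fun x _ => ((hf.differentiable one_ne_zero x).hasDerivAt).ofReal_comp)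
    (integrable_cexp_mul hd hs.deriv z)
    (by
      have := (integrable_cexp_mul hf.continuous hs z).const_mul z
      simpa [Pi.mul_def, mul_assoc] using this)
    (integrable_cexp_mul hf.continuous hs z)
  rw [h]
  simp_rw [mul_assoc]
  rw [integral_const_mul]

lemma norm_integral_cexp_mul_le {f : ℝ → ℝ} (hf : Continuous f) (hs : tsupport f ⊆ Ioo (-T) T)
    (z : ℂ) : ‖∫ x : ℝ, Complex.exp (z * x) * f x‖ ≤ Real.exp (|z.re| * T) * ∫ x, |f x| := by
  have hcs : HasCompactSupport f := isCompact_Icc.of_isClosed_subset (isClosed_tsupport _)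
    (hs.trans Ioo_subset_Icc_self)
  rw [← integral_const_mul]
  refine norm_integral_le_of_norm_le
    ((hf.integrable_of_hasCompactSupport hcs).abs.const_mul _) (.of_forall fun x => ?_)
  rw [norm_mul, norm_cexp_mul_ofReal, Complex.norm_real, Real.norm_eq_abs]
  by_cases hx : f x = 0
  · simp [hx]
  · have hxT := hs (subset_tsupport f hx)
    have : |x| ≤ T := abs_le.2 ⟨hxT.1.le, hxT.2.le⟩
    gcongr ?_ * _
    rw [Real.exp_le_exp]
    calc z.re * x ≤ |z.re * x| := le_abs_self _
      _ = |z.re| * |x| := abs_mul _ _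
      _ ≤ _ := by gcongr

lemma laplace_withDensity (hφ : IsDensity Φ φ) (z : ℂ) :
    laplace Φ z = ∫ x : ℝ, Complex.exp (z * x) * φ x := by
  rw [laplace, hφ.eq_withDensity, integral_withDensity_eq_integral_toReal_smul
    hφ.measurable.ennreal_ofReal (by simp)]
  refine integral_congr_ae (.of_forall fun x => ?_)
  simp [ENNReal.toReal_ofReal (hφ.nonneg x), mul_comm]

lemma integral_density_eq_one [IsProbabilityMeasure Φ] (hφ : IsDensity Φ φ) :
    ∫ x, φ x = 1 := by
  have h := laplace_withDensity hφ 0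
  rw [laplace_zero] at h
  simp only [zero_mul, Complex.exp_zero, one_mul, integral_complex_ofReal] at h
  exact_mod_cast h.symm

lemma sq_mul_laplace (hφ : IsDensity Φ φ) (h2 : IsC2CompactSupportIoo T φ) (z : ℂ) :
    z ^ 2 * laplace Φ z = ∫ x : ℝ, Complex.exp (z * x) * (deriv (deriv φ) x : ℝ) := by
  have hd : ContDiff ℝ 1 (deriv φ) := by
    have h : ContDiff ℝ (1 + 1) φ := by simpa [one_add_one_eq_two] using h2.contDiff
    exact (contDiff_succ_iff_deriv.1 h).2.2
  rw [integral_cexp_mul_deriv hd h2.hasCompactSupport.deriv,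
    integral_cexp_mul_deriv (h2.contDiff.of_le (by norm_num)) h2.hasCompactSupport,
    laplace_withDensity hφ]
  ring

lemma norm_laplace_le_exp [IsProbabilityMeasure Φ] (hφ : IsDensity Φ φ)
    (h2 : IsC2CompactSupportIoo T φ) (z : ℂ) : ‖laplace Φ z‖ ≤ Real.exp (|z.re| * T) := by
  rw [laplace_withDensity hφ]
  refine (norm_integral_cexp_mul_le h2.continuous h2.tsupport_subset z).trans_eq ?_
  simp_rw [abs_of_nonneg (hφ.nonneg _)]
  rw [integral_density_eq_one hφ, mul_one]

lemma norm_sq_mul_norm_laplace_le (hφ : IsDensity Φ φ) (hT : 0 < T)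
    (h2 : IsC2CompactSupportIoo T φ) (hK : ∫ x in (-T)..T, |iteratedDeriv 2 φ x| ≤ K) (z : ℂ) :
    ‖z‖ ^ 2 * ‖laplace Φ z‖ ≤ Real.exp (|z.re| * T) * K := by
  have hs : tsupport (deriv (deriv φ)) ⊆ Ioo (-T) T :=
    ((tsupport_deriv_subset).trans (tsupport_deriv_subset)).trans h2.tsupport_subset
  have hc : Continuous (deriv (deriv φ)) := by
    have := h2.contDiff.continuous_iteratedDeriv 2 le_rfl
    rwa [iteratedDeriv_succ, iteratedDeriv_one] at this
  rw [← norm_pow, ← norm_mul, sq_mul_laplace hφ h2]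
  refine (norm_integral_cexp_mul_le hc hs z).trans ?_
  gcongr
  refine le_trans (le_of_eq ?_) hK
  rw [iteratedDeriv_succ, iteratedDeriv_one, intervalIntegral.integral_of_le (by linarith)]
  refine (setIntegral_eq_integral_of_forall_compl_eq_zero fun x hx => ?_).symm
  rw [abs_eq_zero]
  exact image_eq_zero_of_notMem_tsupport fun h => hx (Ioo_subset_Ioc_self (hs h))

/-- Quadratic decay of the transform along vertical lines. -/
lemma norm_laplace_le_div [IsProbabilityMeasure Φ] (hφ : IsDensity Φ φ) (hT : 0 < T)
    (h2 : IsC2CompactSupportIoo T φ) (hK : ∫ x in (-T)..T, |iteratedDeriv 2 φ x| ≤ K) (z : ℂ) :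
    ‖laplace Φ z‖ ≤ Real.exp (|z.re| * T) * (1 + K) / (1 + z.im ^ 2) := by
  rw [le_div_iff₀ (by positivity)]
  have h1 := norm_laplace_le_exp hφ h2 z
  have h3 := norm_sq_mul_norm_laplace_le hφ hT h2 hK z
  have h4 : z.im ^ 2 ≤ ‖z‖ ^ 2 := by
    rw [← sq_abs]; gcongr; exact Complex.abs_im_le_norm z
  have h5 : z.im ^ 2 * ‖laplace Φ z‖ ≤ ‖z‖ ^ 2 * ‖laplace Φ z‖ := by gcongr
  linarith

lemma integrable_exp_withDensity (hφ : IsDensity Φ φ) (h2 : IsC2CompactSupportIoo T φ) (σ : ℝ) :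
    Integrable (fun x => Real.exp (σ * x)) Φ := by
  rw [hφ.eq_withDensity, integrable_withDensity_iff_integrable_smul'
    hφ.measurable.ennreal_ofReal (by simp)]
  simp_rw [ENNReal.toReal_ofReal (hφ.nonneg _), smul_eq_mul]
  have hc := h2.continuous
  exact Continuous.integrable_of_hasCompactSupport (by fun_prop) h2.hasCompactSupport.mul_right

lemma differentiable_laplace (hφ : IsDensity Φ φ) (h2 : IsC2CompactSupportIoo T φ) :
    Differentiable ℂ (laplace Φ) := fun z => by
  have : ProbabilityTheory.integrableExpSet id Φ = univ :=
    eq_univ_of_forall fun σ => integrable_exp_withDensity hφ h2 σ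
  exact (ProbabilityTheory.hasDerivAt_complexMGF (X := id) (μ := Φ)
    (by simp [this])).differentiableAt

lemma integrable_laplace_vertical [IsProbabilityMeasure Φ] (hφ : IsDensity Φ φ) (hT : 0 < T)
    (h2 : IsC2CompactSupportIoo T φ) (σ : ℝ) :
    Integrable fun t : ℝ => laplace Φ (σ + t * Complex.I) := by
  have hc : Continuous fun t : ℝ => laplace Φ (σ + t * Complex.I) :=
    (differentiable_laplace hφ h2).continuous.comp (by fun_prop)
  refine (integrable_inv_one_add_sq.const_mul
    (Real.exp (|σ| * T) * (1 + ∫ x in (-T)..T, |iteratedDeriv 2 φ x|))).mono'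
    hc.aestronglyMeasurable (.of_forall fun t => ?_)
  simpa [div_eq_mul_inv] using norm_laplace_le_div hφ hT h2 le_rfl (σ + t * Complex.I)

/-- Inversion of the bilateral Laplace transform of a smooth density on any vertical line. -/
lemma density_eq_integral_laplace [IsProbabilityMeasure Φ] (hφ : IsDensity Φ φ) (hT : 0 < T)
    (h2 : IsC2CompactSupportIoo T φ) (σ y : ℝ) :
    (φ y : ℂ) = (2 * Real.pi)⁻¹ * ∫ t : ℝ, Complex.exp (-(σ + t * Complex.I) * y) *
      laplace Φ (σ + t * Complex.I) := by
  open FourierTransform in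
  set f : ℝ → ℂ := fun x => Complex.exp (σ * x) * φ x with hf
  have hc : Continuous φ := h2.continuous
  have hF (w : ℝ) : 𝓕 f w = laplace Φ (σ + (-(2 * Real.pi) * w : ℝ) * Complex.I) := by
    rw [Real.fourier_eq', laplace_withDensity hφ]
    refine integral_congr_ae (.of_forall fun x => ?_)
    simp only [hf, smul_eq_mul, ← mul_assoc, ← Complex.exp_add]
    congr 2
    simp
    ring
  have hFi : Integrable (𝓕 f) := by
    have := (integrable_laplace_vertical hφ hT h2 σ).comp_mul_left'
      (R := -(2 * Real.pi)) (by simp [Real.pi_ne_zero])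
    exact this.congr (.of_forall fun w => (hF w).symm)
  have hinv := congrFun (Continuous.fourierInv_fourier_eq (f := f) (by fun_prop)
    (integrable_cexp_mul hc h2.hasCompactSupport σ) hFi) y
  rw [Real.fourierInv_eq'] at hinv
  have hsub := Measure.integral_comp_mul_left (fun t : ℝ => Complex.exp (-(t * Complex.I) * y) *
    laplace Φ (σ + t * Complex.I)) (-(2 * Real.pi))
  have e1 : ∫ w : ℝ, Complex.exp (((2 * Real.pi * inner ℝ w y : ℝ) : ℂ) * Complex.I) • 𝓕 f w
      = ∫ w : ℝ, Complex.exp (-(((-(2 * Real.pi) * w : ℝ) : ℂ) * Complex.I) * y) *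
        laplace Φ (σ + (-(2 * Real.pi) * w : ℝ) * Complex.I) := by
    refine integral_congr_ae (.of_forall fun w => ?_)
    simp only [hF, smul_eq_mul]
    congr 2
    simp
    ring
  rw [e1, hsub] at hinv
  have e2 : |(-(2 * Real.pi))⁻¹| = (2 * Real.pi)⁻¹ := by
    rw [inv_neg, abs_neg, abs_of_nonneg (by positivity)]
  rw [e2] at hinv
  have e3 : (φ y : ℂ) = Complex.exp (-(σ * y)) * f y := by
    rw [hf, ← mul_assoc, ← Complex.exp_add]; simp
  rw [e3, ← hinv, Complex.real_smul, mul_left_comm, ← integral_const_mul]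
  push_cast
  congr 1
  refine integral_congr_ae (.of_forall fun t => ?_)
  simp only [← mul_assoc, ← Complex.exp_add]
  congr 2
  ring

end Density

/-! ### Smoothed renewal measures as contour integrals -/

section Smoothing

variable {T K : ℝ} {φ : ℝ → ℝ} {Φ : Measure ℝ}

/-- A measure with a finite exponential moment of order `σ`, smoothed by the density `φ`, is
recovered from its bilateral Laplace transform on the line `Re z = σ`. -/
lemma integral_density_sub_eq [IsProbabilityMeasure Φ] (hφ : IsDensity Φ φ) (hT : 0 < T)
    (h2 : IsC2CompactSupportIoo T φ) {ν : Measure ℝ} [SFinite ν] {σ : ℝ}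
    (hν : Integrable (fun y => Real.exp (σ * y)) ν) (x : ℝ) :
    Integrable (fun y => φ (x - y)) ν ∧
    Integrable (fun t : ℝ => Complex.exp (-(σ + t * Complex.I) * x) *
      (laplace Φ (σ + t * Complex.I) * laplace ν (σ + t * Complex.I))) ∧
    ((∫ y, φ (x - y) ∂ν : ℝ) : ℂ) = (2 * Real.pi)⁻¹ * ∫ t : ℝ,
      Complex.exp (-(σ + t * Complex.I) * x) *
        (laplace Φ (σ + t * Complex.I) * laplace ν (σ + t * Complex.I)) := by
  have hLc : Continuous fun t : ℝ => laplace Φ (σ + t * Complex.I) :=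
    (differentiable_laplace hφ h2).continuous.comp (by fun_prop)
  have hF : Integrable (fun q : ℝ × ℝ => Complex.exp (-(σ + q.2 * Complex.I) * (x - q.1 : ℝ)) *
      laplace Φ (σ + q.2 * Complex.I)) (ν.prod volume) := by
    have h1 := (hν.mul_prod (integrable_laplace_vertical hφ hT h2 σ).norm).const_mul
      (Real.exp (-(σ * x)))
    refine h1.mono' ?_ (.of_forall fun q => ?_)
    · have : Continuous fun q : ℝ × ℝ => Complex.exp (-(σ + q.2 * Complex.I) * (x - q.1 : ℝ)) *
          laplace Φ (σ + q.2 * Complex.I) :=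
        Continuous.mul (by fun_prop) (hLc.comp continuous_snd)
      exact this.aestronglyMeasurable
    · rw [norm_mul, norm_cexp_mul_ofReal, ← mul_assoc, ← Real.exp_add]
      apply le_of_eq
      congr 2
      simp
      ring
  have hinv (y : ℝ) : (φ (x - y) : ℂ) = (2 * Real.pi)⁻¹ *
      ∫ t : ℝ, Complex.exp (-(σ + t * Complex.I) * (x - y : ℝ)) *
        laplace Φ (σ + t * Complex.I) := density_eq_integral_laplace hφ hT h2 σ (x - y)
  have hswap (t : ℝ) : ∫ y, Complex.exp (-(σ + t * Complex.I) * (x - y : ℝ)) *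
      laplace Φ (σ + t * Complex.I) ∂ν = Complex.exp (-(σ + t * Complex.I) * x) *
        (laplace Φ (σ + t * Complex.I) * laplace ν (σ + t * Complex.I)) := by
    rw [integral_mul_const, mul_comm (laplace Φ _), ← mul_assoc, laplace.eq_1 ν,
      ← integral_const_mul]
    congr 1
    refine integral_congr_ae (.of_forall fun y => ?_)
    simp only [← Complex.exp_add]
    congr 1
    push_cast
    ring
  refine ⟨?_, ?_, ?_⟩
  · have h3 : Integrable (fun y => (φ (x - y) : ℂ)) ν := by
      simp_rw [hinv]
      exact hF.integral_prod_left.const_mul _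
    exact h3.re
  · simp_rw [← hswap]
    exact hF.integral_prod_right
  · rw [← integral_complex_ofReal]
    simp_rw [hinv]
    rw [integral_const_mul, integral_integral_swap hF]
    simp_rw [hswap]

lemma laplace_restrict_Ioi {z : ℂ} (hz : z.re < 0) :
    laplace (volume.restrict (Ioi 0)) z = -z⁻¹ := by
  rw [laplace, integral_exp_mul_complex_Ioi hz]
  simp [neg_div]

/-- The smoothed Heaviside function `∫_{y > 0} φ(x - y) dy` differs from one only to the left of
`T`, and from zero only to the right of `-T`. -/
lemma smoothed_heaviside_bounds [IsProbabilityMeasure Φ] (hφ : IsDensity Φ φ)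
    (h2 : IsC2CompactSupportIoo T φ) {ρ : ℝ} (hρ : 0 < ρ) (x : ℝ) :
    |(∫ y in Ioi 0, φ (x - y)) - 1| ≤ Real.exp (ρ * T) * Real.exp (-ρ * x) ∧
    |∫ y in Ioi 0, φ (x - y)| ≤ Real.exp (ρ * T) * Real.exp (ρ * x) := by
  have hz (y : ℝ) (hy : T ≤ |y|) : φ y = 0 := by
    refine image_eq_zero_of_notMem_tsupport fun h => ?_
    exact (abs_lt.2 (h2.tsupport_subset h)).not_ge hy
  have htot : ∫ y, φ (x - y) = 1 := by
    rw [integral_sub_left_eq_self, integral_density_eq_one hφ]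
  have hint : Integrable fun y => φ (x - y) :=
    (h2.continuous.integrable_of_hasCompactSupport h2.hasCompactSupport).comp_sub_left x
  have h0 : 0 ≤ ∫ y in Ioi 0, φ (x - y) := integral_nonneg fun y => hφ.nonneg _
  have h1 : ∫ y in Ioi 0, φ (x - y) ≤ 1 := by
    rw [← htot]
    exact setIntegral_le_integral hint (.of_forall fun y => hφ.nonneg _)
  rw [← Real.exp_add, ← Real.exp_add]
  constructor
  · rcases le_or_gt T x with hx | hx
    · rw [setIntegral_eq_integral_of_forall_compl_eq_zero, htot]
      · simpa using Real.exp_nonneg _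
      · intro y hy
        rw [mem_Ioi, not_lt] at hy
        exact hz _ (le_trans (by linarith) (le_abs_self _))
    · refine le_trans (b := 1) (abs_le.2 ⟨by linarith, by linarith⟩) (Real.one_le_exp ?_)
      nlinarith
  · rcases le_or_gt x (-T) with hx | hx
    · rw [setIntegral_eq_zero_of_forall_eq_zero]
      · simpa using Real.exp_nonneg _
      · intro y hy
        rw [mem_Ioi] at hy
        exact hz _ (le_trans (by linarith) (neg_le_abs _))
    · rw [abs_of_nonneg h0]
      refine h1.trans (Real.one_le_exp ?_)
      nlinarith

lemma differentiableAt_laplace {p : Measure ℝ} [IsFiniteMeasure p] {τ : ℝ}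
    (hi : Integrable (fun x => Real.exp (τ * |x|)) p) {z : ℂ} (hz : |z.re| < τ) :
    DifferentiableAt ℂ (laplace p) z := by
  have hsub : Ioo (-τ) τ ⊆ ProbabilityTheory.integrableExpSet id p := fun σ hσ =>
    integrable_exp_mul hi (abs_lt.2 hσ).le
  exact (ProbabilityTheory.hasDerivAt_complexMGF (X := id) (μ := p)
    (interior_maximal hsub isOpen_Ioo (abs_lt.1 hz))).differentiableAt

/-- Bound on an inverse transform along the line `Re z = σ`. -/
lemma norm_integral_vertical_le {H : ℂ → ℂ} {σ B : ℝ}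
    (hB : ∀ t : ℝ, ‖H (σ + t * Complex.I)‖ ≤ B / (1 + t ^ 2)) :
    ‖(((2 * Real.pi)⁻¹ : ℝ) : ℂ) * ∫ t : ℝ, H (σ + t * Complex.I)‖ ≤ B / 2 := by
  have h1 : ‖∫ t : ℝ, H (σ + t * Complex.I)‖ ≤ B * Real.pi := by
    rw [← integral_univ_inv_one_add_sq, ← integral_const_mul]
    exact norm_integral_le_of_norm_le (integrable_inv_one_add_sq.const_mul B)
      (.of_forall fun t => by simpa [div_eq_mul_inv] using hB t)
  rw [norm_mul]
  have h2 : ‖(((2 * Real.pi)⁻¹ : ℝ) : ℂ)‖ = (2 * Real.pi)⁻¹ := by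
    simp [abs_of_pos Real.pi_pos]
  rw [h2]
  calc (2 * Real.pi)⁻¹ * _ ≤ (2 * Real.pi)⁻¹ * (B * Real.pi) := by gcongr
    _ = B / 2 := by field_simp

/-- Exponential convergence of the smoothed renewal measure `φ * N_p`, on both sides, with
constants that depend on `p` only through the parameters of the hypotheses. -/
lemma smoothed_renewal_bounds [IsProbabilityMeasure Φ] (hφ : IsDensity Φ φ) (hT : 0 < T)
    (h2 : IsC2CompactSupportIoo T φ) (hK : ∫ x in (-T)..T, |iteratedDeriv 2 φ x| ≤ K)
    {p : Measure ℝ} [IsProbabilityMeasure p] {τ m ρ ρ' B : ℝ}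
    (hi : Integrable (fun x => Real.exp (τ * |x|)) p) (hm : 0 < m) (hmean : m ≤ mean p)
    (hρ : 0 < ρ) (hρρ' : ρ < ρ') (hρ'τ : ρ' < τ) (hB0 : 0 ≤ B)
    (hstrip : ∀ z : ℂ, |z.re| ≤ ρ' → z ≠ 0 → 1 - laplace p z ≠ 0 ∧
        ‖(1 - laplace p z)⁻¹ + (mean p * z)⁻¹‖ ≤ B)
    (hlt : ∫ x, Real.exp (-ρ * x) ∂p < 1) (x : ℝ) :
    Integrable (fun y => φ (x - y)) (renewalMeasure p) ∧
    |(∫ y, φ (x - y) ∂(renewalMeasure p)) - (mean p)⁻¹|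
      ≤ (Real.exp (ρ' * T) * (1 + K) * B / 2 + m⁻¹ * Real.exp (ρ' * T)) * Real.exp (-ρ * x) ∧
    |∫ y, φ (x - y) ∂(renewalMeasure p)|
      ≤ (Real.exp (ρ' * T) * (1 + K) * B / 2 + m⁻¹ * Real.exp (ρ' * T)) * Real.exp (ρ * x) := by
  have hμ : 0 < mean p := hm.trans_le hmean
  have hK0 : 0 ≤ K := le_trans
    (intervalIntegral.integral_nonneg (by linarith) fun _ _ => abs_nonneg _) hK
  set A : ℝ := Real.exp (ρ' * T) * (1 + K) with hA
  have hA0 : 0 ≤ A := by positivity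
  set G₀ : ℂ → ℂ := fun z => laplace Φ z * ((1 - laplace p z)⁻¹ + (mean p * z)⁻¹) with hG₀
  -- the values near the origin are bounded, so that `G₀` has a removable singularity there
  set G : ℂ → ℂ := Function.update G₀ 0 ((nhdsWithin 0 {0}ᶜ).limUnder G₀) with hG
  have hGne {z : ℂ} (hz : z ≠ 0) : G z = G₀ z := Function.update_of_ne hz _ _
  have hG₀B {z : ℂ} (hz : |z.re| ≤ ρ') (hz0 : z ≠ 0) : ‖G₀ z‖ ≤ A * B / (1 + z.im ^ 2) := by
    rw [hG₀, norm_mul, mul_div_right_comm]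
    gcongr
    · refine (norm_laplace_le_div hφ hT h2 hK z).trans ?_
      rw [hA]
      gcongr
    · exact (hstrip z hz hz0).2
  have hopen : IsOpen {z : ℂ | |z.re| < ρ'} :=
    isOpen_lt (by fun_prop) continuous_const
  have hGd : DifferentiableOn ℂ G {z : ℂ | |z.re| < ρ'} := by
    refine Complex.differentiableOn_update_limUnder_of_bddAbove
      (hopen.mem_nhds (by simpa [abs_zero] using hρ.trans hρρ' : |(0 : ℂ).re| < ρ')) ?_ ⟨A * B, ?_⟩
    · rintro z ⟨hz, hz0⟩
      have hz0' : z ≠ 0 := hz0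
      have hz' : |z.re| < ρ' := hz
      have hμ' : (mean p : ℂ) ≠ 0 := by exact_mod_cast hμ.ne'
      have hp := differentiableAt_laplace hi (hz'.trans hρ'τ)
      have hΦ := differentiable_laplace hφ h2 z
      exact (hΦ.mul ((((differentiableAt_const _).sub hp).inv (hstrip z hz'.le hz0').1).add
        ((differentiableAt_id.const_mul _).inv
          (mul_ne_zero hμ' hz0')))).differentiableWithinAt
    · rintro _ ⟨z, ⟨hz, hz0⟩, rfl⟩
      have hz' : |z.re| < ρ' := hz
      exact (hG₀B hz'.le hz0).trans (div_le_self (by positivity) (by nlinarith [sq_nonneg z.im]))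
  set H : ℂ → ℂ := fun z => Complex.exp (-z * x) * G z with hH
  have hHd : DifferentiableOn ℂ H {z : ℂ | |z.re| < ρ'} :=
    DifferentiableOn.mul (by fun_prop) hGd
  have hHB {z : ℂ} (hz : |z.re| ≤ ρ') (hz0 : z ≠ 0) :
      ‖H z‖ ≤ Real.exp (-z.re * x) * (A * B) / (1 + z.im ^ 2) := by
    rw [hH, norm_mul, norm_cexp_mul_ofReal, hGne hz0, Complex.neg_re, mul_div_assoc]
    gcongr
    exact hG₀B hz hz0
  have hline {σ : ℝ} (hσ0 : σ ≠ 0) (hσ : |σ| = ρ) (t : ℝ) :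
      ‖H (σ + t * Complex.I)‖ ≤ Real.exp (-σ * x) * (A * B) / (1 + t ^ 2) := by
    have := hHB (z := σ + t * Complex.I) (by simp [hσ, hρρ'.le]) (fun h => hσ0 (by
      simpa using congrArg Complex.re h))
    simpa using this
  have hint {σ : ℝ} (hσ0 : σ ≠ 0) (hσ : |σ| = ρ) :
      Integrable fun t : ℝ => H (σ + t * Complex.I) := by
    refine (integrable_inv_one_add_sq.const_mul (Real.exp (-σ * x) * (A * B))).mono' ?_
      (.of_forall fun t => by simpa [div_eq_mul_inv] using hline hσ0 hσ t)
    refine Continuous.aestronglyMeasurable (continuous_iff_continuousAt.2 fun t => ?_)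
    have h1 : ContinuousAt H (σ + t * Complex.I) :=
      (hHd.differentiableAt (hopen.mem_nhds (by simp [hσ, hρρ']))).continuousAt
    exact ContinuousAt.comp (f := fun t : ℝ => (σ + t * Complex.I : ℂ)) h1 (by fun_prop)
  have hshift : ∫ t : ℝ, H ((-ρ : ℝ) + t * Complex.I) = ∫ t : ℝ, H (ρ + t * Complex.I) := by
    refine integral_vertical_eq (B := Real.exp (ρ * |x|) * (A * B)) (by linarith)
      (hHd.mono fun z hz => ?_) (fun z hz him => ?_)
      (hint (by simpa using hρ.ne') (by simp [abs_of_pos hρ])) (hint hρ.ne' (abs_of_pos hρ))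
    · exact (abs_le.2 hz).trans_lt hρρ'
    · have hz0 : z ≠ 0 := by
        rintro rfl
        norm_num at him
      have hre : |z.re| ≤ ρ := abs_le.2 hz
      refine (hHB (hre.trans hρρ'.le) hz0).trans ?_
      gcongr ?_ * _ / _
      rw [Real.exp_le_exp]
      calc -z.re * x ≤ |-z.re * x| := le_abs_self _
        _ = |z.re| * |x| := by rw [abs_mul, abs_neg]
        _ ≤ ρ * |x| := by gcongr
  -- identification of the contour integral over `Re z = -ρ`
  have hρτ : |(-ρ)| ≤ τ := by rw [abs_neg, abs_of_pos hρ]; linarith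
  have hpi : Integrable (fun x => Real.exp (-ρ * x)) p := integrable_exp_mul hi hρτ
  obtain ⟨hN, hNi, hNeq⟩ := integral_density_sub_eq hφ hT h2
    (integrable_exp_renewalMeasure hpi hlt) x
  obtain ⟨-, hSi, hSeq⟩ := integral_density_sub_eq hφ hT h2
    (ν := volume.restrict (Ioi 0)) (σ := -ρ) (integrableOn_exp_mul_Ioi (neg_lt_zero.2 hρ) 0) x
  set g : ℝ := ∫ y, φ (x - y) ∂(renewalMeasure p)
  set s : ℝ := ∫ y in Ioi 0, φ (x - y)
  have hu : ((g - (mean p)⁻¹ * s : ℝ) : ℂ)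
      = (2 * Real.pi)⁻¹ * ∫ t : ℝ, H ((-ρ : ℝ) + t * Complex.I) := by
    rw [Complex.ofReal_sub, Complex.ofReal_mul, hNeq, hSeq, mul_left_comm,
      ← integral_const_mul (((mean p)⁻¹ : ℝ) : ℂ),
      ← mul_sub, ← integral_sub hNi (hSi.const_mul _)]
    congr 1
    refine integral_congr_ae (.of_forall fun t => ?_)
    have hre : (((-ρ : ℝ) : ℂ) + t * Complex.I).re = -ρ := by simp
    have hz0 : ((-ρ : ℝ) : ℂ) + t * Complex.I ≠ 0 := fun h => by
      rw [h] at hre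
      simp at hre
      linarith
    simp only [hH, hGne hz0, hG₀]
    rw [laplace_renewalMeasure (by rwa [hre]) (by rwa [hre]),
      laplace_restrict_Ioi (by rw [hre]; linarith), mul_inv]
    push_cast
    ring
  have hu₁ : |g - (mean p)⁻¹ * s| ≤ Real.exp (ρ * x) * (A * B) / 2 := by
    rw [← Real.norm_eq_abs, ← Complex.norm_real, hu]
    refine norm_integral_vertical_le fun t => ?_
    simpa using hline (σ := -ρ) (by simpa using hρ.ne') (by simp [abs_of_pos hρ]) t
  have hu₂ : |g - (mean p)⁻¹ * s| ≤ Real.exp (-ρ * x) * (A * B) / 2 := by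
    rw [← Real.norm_eq_abs, ← Complex.norm_real, hu, hshift]
    exact norm_integral_vertical_le (hline hρ.ne' (abs_of_pos hρ))
  obtain ⟨hs₁, hs₂⟩ := smoothed_heaviside_bounds hφ h2 hρ x
  change |s - 1| ≤ _ at hs₁
  change |s| ≤ _ at hs₂
  have hinv : (mean p)⁻¹ ≤ m⁻¹ := by gcongr
  have hexp : Real.exp (ρ * T) ≤ Real.exp (ρ' * T) := by gcongr
  refine ⟨hN, ?_, ?_⟩
  · have e : g - (mean p)⁻¹ = (g - (mean p)⁻¹ * s) + (mean p)⁻¹ * (s - 1) := by ring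
    rw [e]
    refine (abs_add_le _ _).trans ?_
    rw [abs_mul, abs_of_pos (inv_pos.2 hμ)]
    calc _ ≤ Real.exp (-ρ * x) * (A * B) / 2
          + m⁻¹ * (Real.exp (ρ' * T) * Real.exp (-ρ * x)) := by
          gcongr
          exact hs₁.trans (by gcongr)
      _ = _ := by ring
  · have e : g = (g - (mean p)⁻¹ * s) + (mean p)⁻¹ * s := by ring
    rw [e]
    refine (abs_add_le _ _).trans ?_
    rw [abs_mul, abs_of_pos (inv_pos.2 hμ)]
    calc _ ≤ Real.exp (ρ * x) * (A * B) / 2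
          + m⁻¹ * (Real.exp (ρ' * T) * Real.exp (ρ * x)) := by
          gcongr
          exact hs₂.trans (by gcongr)
      _ = _ := by ring

end Smoothing

/-! ### Averages, submeasures and mixtures -/

/-- Averaging a function with two-sided exponential bounds over a probability measure with a
suitable exponential moment preserves these bounds. -/
lemma average_bounds {κ : Measure ℝ} [IsProbabilityMeasure κ] {g : ℝ → ℝ} (hg : Measurable g)
    {ρ A D c : ℝ} (hρ : 0 < ρ) (hi : Integrable (fun w => Real.exp (ρ * |w|)) κ)
    (hD : ∫ w, Real.exp (ρ * |w|) ∂κ ≤ D) (hA : 0 ≤ A)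
    (h1 : ∀ x, |g x - c| ≤ A * Real.exp (-ρ * x)) (h2 : ∀ x, |g x| ≤ A * Real.exp (ρ * x))
    (x : ℝ) : Integrable (fun w => g (x - w)) κ ∧
      |(∫ w, g (x - w) ∂κ) - c| ≤ A * D * Real.exp (-ρ * x) ∧
      |∫ w, g (x - w) ∂κ| ≤ A * D * Real.exp (ρ * x) := by
  have hb1 (w : ℝ) : ‖g (x - w) - c‖ ≤ A * Real.exp (-ρ * x) * Real.exp (ρ * |w|) := by
    refine (h1 _).trans ?_
    rw [mul_assoc, ← Real.exp_add]
    gcongr A * Real.exp ?_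
    nlinarith [le_abs_self w]
  have hb2 (w : ℝ) : ‖g (x - w)‖ ≤ A * Real.exp (ρ * x) * Real.exp (ρ * |w|) := by
    refine (h2 _).trans ?_
    rw [mul_assoc, ← Real.exp_add]
    gcongr A * Real.exp ?_
    nlinarith [neg_le_abs w]
  have hint : Integrable (fun w => g (x - w)) κ :=
    (hi.const_mul _).mono' (hg.comp (measurable_const.sub measurable_id)).aestronglyMeasurable
      (.of_forall hb2)
  refine ⟨hint, ?_, ?_⟩
  · have e : (∫ w, g (x - w) ∂κ) - c = ∫ w, (g (x - w) - c) ∂κ := by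
      rw [integral_sub hint (integrable_const _)]; simp
    rw [e, ← Real.norm_eq_abs]
    refine (norm_integral_le_of_norm_le (hi.const_mul _) (.of_forall hb1)).trans ?_
    rw [integral_const_mul, mul_right_comm]
    gcongr
  · rw [← Real.norm_eq_abs]
    refine (norm_integral_le_of_norm_le (hi.const_mul _) (.of_forall hb2)).trans ?_
    rw [integral_const_mul, mul_right_comm]
    gcongr

/-- The density of `(κ ∗ ν) ∗ Φ`, given as an average over `κ` of the function `g = φ * ν`. -/
lemma lintegral_conv_density {κ ν : Measure ℝ} [SFinite ν] {φ g : ℝ → ℝ}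
    (hφm : Measurable φ) (hφ0 : ∀ x, 0 ≤ φ x)
    (hν : ∀ x, Integrable (fun y => φ (x - y)) ν) (hg : ∀ x, g x = ∫ y, φ (x - y) ∂ν) {x : ℝ}
    (hκ : Integrable (fun w => g (x - w)) κ) :
    ∫⁻ y, ENNReal.ofReal (φ (x - y)) ∂(κ ∗ ν) = ENNReal.ofReal (∫ w, g (x - w) ∂κ) := by
  have hm : Measurable fun y => ENNReal.ofReal (φ (x - y)) :=
    (hφm.comp (measurable_const.sub measurable_id)).ennreal_ofReal
  rw [Measure.lintegral_conv hm, ofReal_integral_eq_lintegral_ofReal hκ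
    (.of_forall fun w => by
      simp only [hg]
      exact integral_nonneg fun y => hφ0 _)]
  refine lintegral_congr fun w => ?_
  rw [hg, ofReal_integral_eq_lintegral_ofReal (hν _) (.of_forall fun y => hφ0 _)]
  simp_rw [sub_sub]

lemma ofReal_exp_mul_abs_add_le {ρ : ℝ} (hρ : 0 ≤ ρ) (x y : ℝ) :
    ENNReal.ofReal (Real.exp (ρ * |x + y|))
      ≤ ENNReal.ofReal (Real.exp (ρ * |x|)) * ENNReal.ofReal (Real.exp (ρ * |y|)) := by
  rw [← ENNReal.ofReal_mul (Real.exp_nonneg _), ← Real.exp_add, ← mul_add]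
  gcongr
  exact abs_add_le x y

/-- A submeasure of mass `l` of a law with exponential moment of order `τ` has small moments of
order `ρ`, close to `l`, when `ρ` is small. -/
lemma lintegral_exp_le_of_le {p S : Measure ℝ} {τ ρ C l θ : ℝ} (hSp : S ≤ p)
    (hS : S univ = ENNReal.ofReal l) (hl : 0 ≤ l) (hτ : 0 < τ) (hρ : 0 < ρ) (hρτ : ρ ≤ τ)
    (hC0 : 0 ≤ C) (hC : ∫⁻ x, ENNReal.ofReal (Real.exp (τ * |x|)) ∂p ≤ ENNReal.ofReal C)
    (hθ : l + ρ / τ * C ≤ θ) :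
    ∫⁻ x, ENNReal.ofReal (Real.exp (ρ * |x|)) ∂S ≤ ENNReal.ofReal θ := by
  calc ∫⁻ x, ENNReal.ofReal (Real.exp (ρ * |x|)) ∂S
      ≤ ∫⁻ x, (1 + ENNReal.ofReal (ρ / τ) * ENNReal.ofReal (Real.exp (τ * |x|))) ∂S := by
        refine lintegral_mono fun x => ?_
        rw [← ENNReal.ofReal_one, ← ENNReal.ofReal_mul (by positivity),
          ← ENNReal.ofReal_add zero_le_one (by positivity)]
        have := exp_mul_abs_sub_one_le hτ hρ.le hρτ x
        exact ENNReal.ofReal_le_ofReal (by linarith)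
    _ = S univ + ENNReal.ofReal (ρ / τ) * ∫⁻ x, ENNReal.ofReal (Real.exp (τ * |x|)) ∂S := by
        rw [lintegral_add_left measurable_const, lintegral_const_mul _ (by fun_prop)]
        simp
    _ ≤ ENNReal.ofReal l + ENNReal.ofReal (ρ / τ) * ENNReal.ofReal C := by
        rw [hS]
        gcongr
        exact (lintegral_mono' hSp le_rfl).trans hC
    _ = ENNReal.ofReal (l + ρ / τ * C) := by
        rw [← ENNReal.ofReal_mul (by positivity), ← ENNReal.ofReal_add hl (by positivity)]
    _ ≤ _ := ENNReal.ofReal_le_ofReal hθ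

/-- At high frequencies the smooth component keeps the characteristic function of the mixture
away from one. -/
lemma norm_laplace_mixture_le {p Φ Ψ : Measure ℝ} [IsProbabilityMeasure Φ]
    [IsProbabilityMeasure Ψ] {l : ℝ} (hl0 : 0 ≤ l) (hl1 : l < 1)
    (hmix : p = ENNReal.ofReal (1 - l) • Φ + ENNReal.ofReal l • Ψ) {φ : ℝ → ℝ}
    (hφ : IsDensity Φ φ) {T K : ℝ} (hT : 0 < T) (h2 : IsC2CompactSupportIoo T φ)
    (hK : ∫ x in (-T)..T, |iteratedDeriv 2 φ x| ≤ K) {t : ℝ} (ht : 2 * K + 1 ≤ |t|) :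
    ‖laplace p (t * Complex.I)‖ ≤ (1 + l) / 2 := by
  have hK0 : 0 ≤ K := le_trans
    (intervalIntegral.integral_nonneg (by linarith) fun _ _ => abs_nonneg _) hK
  have hiΦ : Integrable (fun x : ℝ => Complex.exp (t * Complex.I * x)) Φ :=
    integrable_cexp (by simp)
  have hiΨ : Integrable (fun x : ℝ => Complex.exp (t * Complex.I * x)) Ψ :=
    integrable_cexp (by simp)
  have e : laplace p (t * Complex.I)
      = (1 - l : ℝ) • laplace Φ (t * Complex.I) + l • laplace Ψ (t * Complex.I) := by
    rw [laplace, hmix, integral_add_measure (hiΦ.smul_measure (by simp))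
      (hiΨ.smul_measure (by simp)), integral_smul_measure, integral_smul_measure,
      ENNReal.toReal_ofReal (by linarith), ENNReal.toReal_ofReal hl0]
    rfl
  have hΨ : ‖laplace Ψ (t * Complex.I)‖ ≤ 1 := by
    simpa using norm_laplace_le Ψ (t * Complex.I)
  have hΦ : ‖laplace Φ (t * Complex.I)‖ ≤ 1 / 2 := by
    have h := norm_sq_mul_norm_laplace_le hφ hT h2 hK (t * Complex.I)
    simp only [norm_mul, Complex.norm_real, Complex.norm_I, mul_one, Complex.mul_re,
      Complex.ofReal_re, Complex.I_re, mul_zero, Complex.ofReal_im, Complex.I_im, sub_self,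
      abs_zero, zero_mul, Real.exp_zero, one_mul, Real.norm_eq_abs] at h
    -- `‖Φ̂(it)‖ ≤ K / t²` and `t² ≥ 2 K`, as `|t| ≥ 2 K + 1 ≥ 1`
    have ht2 : 2 * K + 1 ≤ |t| ^ 2 := by nlinarith
    have h0 := norm_nonneg (laplace Φ (t * Complex.I))
    nlinarith [mul_le_mul_of_nonneg_right ht2 h0]
  rw [e]
  refine (norm_add_le _ _).trans ?_
  rw [norm_smul, norm_smul, Real.norm_of_nonneg hl0, Real.norm_of_nonneg (by linarith)]
  nlinarith

end Renewal

/-! ### Uniform convergence of renewal measures -/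

open Renewal

theorem theorem1p1 (M : Set (Measure ℝ)) (hM : ∀ p ∈ M, IsProbabilityMeasure p)
    -- the means are bounded away from zero
    (hmean : ∃ m : ℝ, 0 < m ∧ ∀ p ∈ M, m ≤ Renewal.mean p)
    -- uniformly bounded exponential moments
    (hexp : ∃ τ : ℝ, 0 < τ ∧ ∃ C : ℝ, ∀ p ∈ M,
      ∫⁻ x, ENNReal.ofReal (Real.exp (τ * |x|)) ∂p ≤ ENNReal.ofReal C)
    -- the mixture decompositions
    (lam : Measure ℝ → ℝ) (Φ Ψ : Measure ℝ → Measure ℝ) (φ : Measure ℝ → ℝ → ℝ)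
    (hlam : ∀ p ∈ M, 0 ≤ lam p ∧ lam p < 1)
    (hΦ : ∀ p ∈ M, IsProbabilityMeasure (Φ p))
    (hΨ : ∀ p ∈ M, IsProbabilityMeasure (Ψ p))
    (hmix : ∀ p ∈ M, p = ENNReal.ofReal (1 - lam p) • Φ p + ENNReal.ofReal (lam p) • Ψ p)
    (hφ : ∀ p ∈ M, Renewal.IsDensity (Φ p) (φ p))
    (hγ : ∃ γ : ℝ, γ < 1 ∧ ∀ p ∈ M, lam p ≤ γ)
    -- uniform smoothness of the density components
    (hsmooth : ∃ T : ℝ, 0 < T ∧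
      (∀ p ∈ M, Renewal.IsC2CompactSupportIoo T (φ p)) ∧
      ∃ K : ℝ, ∀ p ∈ M, ∫ x in (-T)..T, |iteratedDeriv 2 (φ p) x| ≤ K) :
    ∃ (Q Nbar : Measure ℝ → Measure ℝ) (q : Measure ℝ → ℝ → ℝ),
      (∀ p ∈ M, Renewal.renewalMeasure p = Q p + Nbar p) ∧
      (∀ p ∈ M, Renewal.IsDensity (Q p) (q p)) ∧
      (∃ B : ℝ, ∀ p ∈ M, Nbar p univ ≤ ENNReal.ofReal B) ∧
      ∃ r₀ : ℝ, 0 < r₀ ∧ ∀ r : ℝ, 0 < r → r < r₀ →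
        (∃ A₁ : ℝ, ∀ p ∈ M, ∀ x : ℝ, 0 < x →
          Real.exp (r * x) * |q p x - (Renewal.mean p)⁻¹| ≤ A₁ ∧
          Real.exp (r * x) * q p (-x) ≤ A₁) ∧
        (∃ A₂ : ℝ, ∀ p ∈ M, ∀ x : ℝ, 0 < x →
          ENNReal.ofReal (Real.exp (r * x)) * Nbar p (Iic (-x) ∪ Ici x)
            ≤ ENNReal.ofReal A₂) := by
  obtain ⟨m, hm, hmean⟩ := hmean
  obtain ⟨τ, hτ, C₀, hexp⟩ := hexp
  obtain ⟨γ, hγ1, hγ⟩ := hγ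
  obtain ⟨T, hT, hsm, K, hK⟩ := hsmooth
  set C : ℝ := max C₀ 1 with hCdef
  have hC1 : 1 ≤ C := le_max_right _ _
  replace hexp (p) (hp : p ∈ M) :
      ∫⁻ x, ENNReal.ofReal (Real.exp (τ * |x|)) ∂p ≤ ENNReal.ofReal C :=
    (hexp p hp).trans (ENNReal.ofReal_le_ofReal (le_max_left _ _))
  set θ : ℝ := (1 + γ) / 2 with hθdef
  have hθ1 : θ < 1 := by linarith
  obtain ⟨ρ', hρ', hρ'τ, B, hB0, hstrip⟩ :=
    exists_strip_bound (t₀ := 2 * K + 1) hτ hC1 hm hθ1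
  -- the exponent is small enough for the strip and for the geometric series of `λ Ψ`
  set ρ : ℝ := min (ρ' / 2) (τ * (1 - γ) / (2 * C)) with hρdef
  have hρ : 0 < ρ := lt_min (by positivity)
    (div_pos (mul_pos hτ (by linarith)) (by positivity))
  have hρρ' : ρ < ρ' := (min_le_left _ _).trans_lt (by linarith)
  have hργ : γ + ρ / τ * C ≤ θ := by
    have : ρ ≤ τ * (1 - γ) / (2 * C) := min_le_right _ _
    rw [le_div_iff₀ (by positivity)] at this
    have : ρ / τ * C ≤ (1 - γ) / 2 := by
      rw [div_mul_eq_mul_div, div_le_iff₀ hτ]; linarith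
    linarith
  set D : ℝ := (1 - θ)⁻¹ with hDdef
  have hD0 : 0 < D := inv_pos.2 (by linarith)
  set A : ℝ := Real.exp (ρ' * T) * (1 + K) * B / 2 + m⁻¹ * Real.exp (ρ' * T) with hAdef
  set Nbar : Measure ℝ → Measure ℝ :=
    fun p => renewalMeasure (ENNReal.ofReal (lam p) • Ψ p) with hNbar
  set κ : Measure ℝ → Measure ℝ := fun p => ENNReal.ofReal (1 - lam p) • Nbar p with hκ
  -- a real number by `toReal`; the integral is finite for `p ∈ M` at every point, see `hqE`
  set q : Measure ℝ → ℝ → ℝ := fun p x =>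
    (∫⁻ y, ENNReal.ofReal (φ p (x - y)) ∂(κ p ∗ renewalMeasure p)).toReal with hq
  have hsub (p) (hp : p ∈ M) : ENNReal.ofReal (lam p) • Ψ p ≤ p := by
    conv_rhs => rw [hmix p hp]
    exact Measure.le_add_left le_rfl
  -- the finite part of the decomposition has a uniformly bounded exponential moment
  have hNexp (p) (hp : p ∈ M) :
      ∫⁻ x, ENNReal.ofReal (Real.exp (ρ * |x|)) ∂(Nbar p) ≤ ENNReal.ofReal D := by
    have := hΨ p hp
    have h1 := lintegral_exp_le_of_le (θ := θ) (hsub p hp) (l := lam p) (by simp) (hlam p hp).1 hτ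
      hρ (by linarith) (by linarith) (hexp p hp) (by linarith [hγ p hp])
    have hfin : IsFiniteMeasure (ENNReal.ofReal (lam p) • Ψ p) :=
      Measure.smul_finite _ ENNReal.ofReal_ne_top
    refine (lintegral_renewalMeasure_le (by fun_prop) (by simp)
      (ofReal_exp_mul_abs_add_le hρ.le) _).trans ?_
    rw [hDdef, ENNReal.ofReal_inv_of_pos (by linarith), ENNReal.ofReal_sub _ (by
      linarith [(hlam p hp).1, hγ p hp]), ENNReal.ofReal_one]
    gcongr
  have hmain (p) (hp : p ∈ M) :
      renewalMeasure p = ((κ p ∗ renewalMeasure p) ∗ Φ p) + Nbar p ∧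
      IsDensity ((κ p ∗ renewalMeasure p) ∗ Φ p) (q p) ∧
      ∀ x, |q p x - (mean p)⁻¹| ≤ A * D * Real.exp (-ρ * x) ∧
        |q p x| ≤ A * D * Real.exp (ρ * x) := by
    have := hM p hp
    have := hΦ p hp
    have := hΨ p hp
    obtain ⟨hl0, hl1⟩ := hlam p hp
    have hfinΨ : IsFiniteMeasure (ENNReal.ofReal (lam p) • Ψ p) :=
      Measure.smul_finite _ ENNReal.ofReal_ne_top
    have hfinΦ : IsFiniteMeasure (ENNReal.ofReal (1 - lam p) • Φ p) :=
      Measure.smul_finite _ ENNReal.ofReal_ne_top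
    have hsfN : SFinite (Nbar p) := sFinite_renewalMeasure _
    have hK0 : 0 ≤ K := le_trans
      (intervalIntegral.integral_nonneg (by linarith) fun _ _ => abs_nonneg _) (hK p hp)
    have hA0 : 0 ≤ A := by positivity
    have hint : Integrable (fun x => Real.exp (τ * |x|)) p :=
      (integrable_iff_lintegral_ofReal_exp (by fun_prop)).2
        ((hexp p hp).trans_lt ENNReal.ofReal_lt_top)
    have hintC : ∫ x, Real.exp (τ * |x|) ∂p ≤ C := by
      rw [integral_eq_lintegral_of_nonneg_ae (.of_forall fun x => Real.exp_nonneg _)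
        hint.aestronglyMeasurable]
      exact ENNReal.toReal_le_of_le_ofReal (by linarith) (hexp p hp)
    have hhigh (t : ℝ) (ht : 2 * K + 1 ≤ |t|) : ‖laplace p (t * Complex.I)‖ ≤ θ :=
      (norm_laplace_mixture_le hl0 hl1 (hmix p hp) (hφ p hp) hT (hsm p hp) (hK p hp) ht).trans
        (by linarith [hγ p hp])
    obtain ⟨hst, hlt⟩ := hstrip p hint hintC (hmean p hp) hhigh
    set g : ℝ → ℝ := fun x => ∫ y, φ p (x - y) ∂(renewalMeasure p) with hg
    have hbounds := smoothed_renewal_bounds (hφ p hp) hT (hsm p hp) (hK p hp) hint hm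
      (hmean p hp) hρ hρρ' hρ'τ hB0 hst (hlt ρ hρ hρρ'.le)
    have hgm : Measurable g := by
      have : Measurable (Function.uncurry fun x y => φ p (x - y)) :=
        (hφ p hp).measurable.comp (measurable_fst.sub measurable_snd)
      exact this.stronglyMeasurable.integral_prod_right.measurable
    -- the factor `1 - λ` normalizes the mass `1 / (1 - λ)` of `Nbar`
    have hκprob : IsProbabilityMeasure (κ p) := by
      constructor
      rw [hκ, hNbar, Measure.smul_apply, renewalMeasure_univ, Measure.smul_apply, measure_univ,
        smul_eq_mul, smul_eq_mul, mul_one, ← ENNReal.ofReal_one, ← ENNReal.ofReal_sub _ hl0]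
      rw [ENNReal.ofReal_one]
      exact ENNReal.mul_inv_cancel (ENNReal.ofReal_pos.2 (sub_pos.2 hl1)).ne'
        ENNReal.ofReal_ne_top
    have hκexp : ∫⁻ x, ENNReal.ofReal (Real.exp (ρ * |x|)) ∂(κ p) ≤ ENNReal.ofReal D := by
      rw [hκ, lintegral_smul_measure, smul_eq_mul]
      refine le_trans ?_ (hNexp p hp)
      exact mul_le_of_le_one_left' (ENNReal.ofReal_le_one.2 (by linarith))
    have hκint : Integrable (fun x => Real.exp (ρ * |x|)) (κ p) :=
      (integrable_iff_lintegral_ofReal_exp (by fun_prop)).2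
        (hκexp.trans_lt ENNReal.ofReal_lt_top)
    have hκD : ∫ x, Real.exp (ρ * |x|) ∂(κ p) ≤ D := by
      rw [integral_eq_lintegral_of_nonneg_ae (.of_forall fun x => Real.exp_nonneg _)
        hκint.aestronglyMeasurable]
      exact ENNReal.toReal_le_of_le_ofReal hD0.le hκexp
    have havg := average_bounds hgm hρ hκint hκD hA0 (fun x => (hbounds x).2.1)
      (fun x => (hbounds x).2.2)
    have hqE (x : ℝ) : ∫⁻ y, ENNReal.ofReal (φ p (x - y)) ∂(κ p ∗ renewalMeasure p)
        = ENNReal.ofReal (∫ w, g (x - w) ∂(κ p)) :=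
      lintegral_conv_density (hφ p hp).measurable (hφ p hp).nonneg
        (fun x => (hbounds x).1) (fun _ => rfl) (havg x).1
    have hqR (x : ℝ) : q p x = ∫ w, g (x - w) ∂(κ p) := by
      rw [hq]
      simp only [hqE]
      exact ENNReal.toReal_ofReal (integral_nonneg fun w => integral_nonneg fun y =>
        (hφ p hp).nonneg _)
    refine ⟨?_, ⟨?_, fun x => ENNReal.toReal_nonneg, ?_⟩, fun x => ?_⟩
    · have h := renewalMeasure_add (ENNReal.ofReal (lam p) • Ψ p)
        (ENNReal.ofReal (1 - lam p) • Φ p)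
      rw [add_comm (ENNReal.ofReal (lam p) • Ψ p), ← hmix p hp] at h
      refine h.trans ?_
      rw [add_comm, Measure.conv_smul_right]
      simp only [hκ, Measure.conv_smul_left]
      rfl
    · refine Measurable.ennreal_toReal ?_
      have : Measurable (Function.uncurry fun x y => ENNReal.ofReal (φ p (x - y))) :=
        ((hφ p hp).measurable.comp (measurable_fst.sub measurable_snd)).ennreal_ofReal
      exact Measurable.lintegral_prod_right this
    · have hd := (hφ p hp).eq_withDensity
      have : SFinite (volume.withDensity fun x => ENNReal.ofReal (φ p x)) := by
        rw [← hd]; infer_instance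
      rw [hd, conv_withDensity _ (hφ p hp).measurable.ennreal_ofReal]
      congr 1
      ext1 x
      rw [hqR, hqE]
    · rw [hqR]
      exact (havg x).2
  refine ⟨fun p => (κ p ∗ renewalMeasure p) ∗ Φ p, Nbar, q, fun p hp => (hmain p hp).1,
    fun p hp => (hmain p hp).2.1, ⟨D, fun p hp => ?_⟩, ρ, hρ, fun r hr hrρ =>
    ⟨⟨A * D, fun p hp x hx => ?_⟩, D, fun p hp x hx => ?_⟩⟩
  · refine le_trans ?_ (hNexp p hp)
    rw [← lintegral_one]
    refine lintegral_mono fun x => ?_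
    simpa using by positivity
  · have hmul {a : ℝ} (h : a ≤ A * D * Real.exp (-ρ * x)) : Real.exp (r * x) * a ≤ A * D := by
      have hAD : 0 ≤ A * D * Real.exp (-ρ * x) :=
        (abs_nonneg _).trans ((hmain p hp).2.2 x).1
      calc Real.exp (r * x) * a ≤ Real.exp (r * x) * (A * D * Real.exp (-ρ * x)) := by gcongr
        _ ≤ Real.exp (ρ * x) * (A * D * Real.exp (-ρ * x)) := by gcongr
        _ = A * D * (Real.exp (ρ * x) * Real.exp (-ρ * x)) := by ring
        _ = A * D := by rw [← Real.exp_add]; simp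
    refine ⟨hmul ((hmain p hp).2.2 x).1, hmul ?_⟩
    have h := ((hmain p hp).2.2 (-x)).2
    rw [mul_neg, ← neg_mul] at h
    exact (le_abs_self _).trans h
  · refine le_trans ?_ (hNexp p hp)
    refine le_trans ?_ (mul_meas_ge_le_lintegral (by fun_prop)
      (ENNReal.ofReal (Real.exp (r * x))))
    gcongr
    intro w hw
    have hxw : x ≤ |w| := by
      rcases hw with hw | hw
      · exact (le_neg.1 hw).trans (neg_le_abs w)
      · exact (mem_Ici.1 hw).trans (le_abs_self w)
    refine ENNReal.ofReal_le_ofReal (Real.exp_le_exp.2 ?_)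
    gcongr
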